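/- Let $(\mathcal C,\otimes,E)$ be a closed symmetric monoidal category with equalizers, with structure isomorphisms $\alpha,\lambda,\rho$. Let $\mathbb T=(T,\mu,\eta)$ be a monoidal monad on $\mathcal C$: there is a natural family $\kappa_{X,Y}:TX\otimes TY\to T(X\otimes Y)$ such that $(T,\kappa,\eta_E)$ is a lax monoidal functor, $\mu_{X\otimes Y}\cdot T\kappa_{X,Y}\cdot\kappa_{TX,TY}=\kappa_{X,Y}\cdot(\mu_X\otimes\mu_Y)$ and $\kappa_{X,Y}\cdot(\eta_X\otimes\eta_Y)=\eta_{X\otimes Y}$ (compatibility of $\kappa$ with the symmetry is not required). Suppose that the category $\mathcal C^{\mathbb T}$ of Eilenberg–Moore algebras has tensors, that is, for all $\mathbb T$-algebras $(A,a)$, $(B,b)$ the pair $$\mu_{A\otimes B}\cdot T\kappa_{A,B},\ T(a\otimes b):\ T(TA\otimes TB)\rightrightarrows T(A\otimes B)$$ has a coequalizer in $\mathcal C^{\mathbb T}$, and choose such coequalizers $q_{A,B}:T(A\otimes B)\to A\boxtimes B$. For morphisms of algebras $g:A\to A'$, $h:B\to B'$ let $g\boxtimes h:A\boxtimes B\to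 A'\boxtimes B'$ be the unique morphism of algebras with $(g\boxtimes h)\cdot q_{A,B}=q_{A',B'}\cdot T(g\otimes h)$. Identify $TX\boxtimes TY$ with $T(X\otimes Y)$ by the isomorphism whose composite with $q_{TX,TY}$ is $\mu_{X\otimes Y}\cdot T\kappa_{X,Y}$. Then there are unique families of isomorphisms of algebras $$\overline\alpha_{A,B,C}:(A\boxtimes B)\boxtimes C\to A\boxtimes(B\boxtimes C),\quad \overline\lambda_A:TE\boxtimes A\to A,\quad \overline\rho_A:A\boxtimes TE\to A$$ (for all $\mathbb T$-algebras $(A,a),(B,b),(C,c)$) that are induced by $\alpha,\lambda,\rho$ in the sense that $$\overline\alpha_{A,B,C}\cdot(q_{A,B}\boxtimes c)=(a\boxtimes q_{B,C})\cdot T\alpha_{A,B,C},$$ $$\overline\lambda_A\cdot q_{TE,A}=a\cdot T\bigl(a\cdot T\lambda_A\cdot\kappa_{E,A}\cdot(1_{TE}\otimes\eta_A)\bigr),\qquad \overline\rho_A\cdot q_{A,TE}=a\cdot T\bigl(a\cdot T\rho_A\cdot\kappa_{A,E}\cdot(\eta_A\otimes1_{TE})\bigr),$$ and, with these isomorphisms,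 $(\mathcal C^{\mathbb T},\boxtimes,TE)$ is a monoidal category. -/

import Mathlib

open CategoryTheory MonoidalCategory Limits

universe v u

/-- A monoidal monad: a monad `T` whose underlying endofunctor carries a lax monoidal structure
`(κ, ε)` with `ε = η_E`, such that `κ` is compatible with the multiplication and the unit of `T`.
No compatibility with a symmetry of `C` is required. -/
class MonoidalMonad {C : Type u} [Category.{v} C] [MonoidalCategory C] (T : Monad C) extends
    T.toFunctor.LaxMonoidal where
  ε_eq_η : ε = T.η.app (𝟙_ C)
  tensor_mul : ∀ X Y : C,
    μ (T.obj X) (T.obj Y) ≫ T.map (μ X Y) ≫ T.μ.app (X ⊗ Y) =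
      (T.μ.app X ⊗ₘ T.μ.app Y) ≫ μ X Y
  tensor_unit : ∀ X Y : C, (T.η.app X ⊗ₘ T.η.app Y) ≫ μ X Y = T.η.app (X ⊗ Y)

namespace MonoidalMonad

section Basic

variable {C : Type u} [Category.{v} C] (T : Monad C)

/-- The structure map `a : TA ⟶ A` of an algebra `(A, a)`, as a morphism of algebras. -/
def str (A : T.Algebra) : T.free.obj A.A ⟶ A where
  f := A.a
  h := A.assoc.symm

/-- The morphism of algebras `b · Tf : TX ⟶ B` that extends `f : X ⟶ B`. -/
def extend {X : C} (B : T.Algebra) (f : X ⟶ B.A) : T.free.obj X ⟶ B :=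
  T.free.map f ≫ str T B

theorem map_unit_mul [MonoidalCategory C] (X Y : C) :
    T.free.map (T.map (T.η.app X) ⊗ₘ T.map (T.η.app Y)) ≫
      T.free.map (T.μ.app X ⊗ₘ T.μ.app Y) = 𝟙 (T.free.obj (T.obj X ⊗ T.obj Y)) := by
  rw [← T.free.map_comp, tensorHom_comp_tensorHom, T.right_unit, T.right_unit]
  exact (congrArg T.free.map (id_tensorHom_id _ _)).trans (T.free.map_id _)

end Basic

section Tensor

variable {C : Type u} [Category.{v} C] [MonoidalCategory C] (T : Monad C) [MonoidalMonad T]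

/-- The natural map `κ_{X,Y} : TX ⊗ TY ⟶ T(X ⊗ Y)` of a monoidal monad. -/
def kappa (X Y : C) : T.obj X ⊗ T.obj Y ⟶ T.obj (X ⊗ Y) :=
  Functor.LaxMonoidal.μ T.toFunctor X Y

/-- The morphism of algebras `μ · Tκ_{X,Y} : T(TX ⊗ TY) ⟶ T(X ⊗ Y)`. -/
def kappaExt (X Y : C) : T.free.obj (T.obj X ⊗ T.obj Y) ⟶ T.free.obj (X ⊗ Y) :=
  extend T (T.free.obj (X ⊗ Y)) (kappa T X Y)

/-- A choice, for all algebras `(A, a)` and `(B, b)`, of a coequalizer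
`q : T(A ⊗ B) ⟶ A ⊠ B` in the category of algebras of the pair
`μ · Tκ, T(a ⊗ b) : T(TA ⊗ TB) ⇉ T(A ⊗ B)`. -/
structure Tensors where
  cofork (A B : T.Algebra) : Cofork (kappaExt T A.A B.A) (T.free.map (A.a ⊗ₘ B.a))
  isColimit (A B : T.Algebra) : IsColimit (cofork A B)

/-- Such a choice exists if and only if all these pairs have coequalizers. -/
theorem nonempty_tensors_iff :
    Nonempty (Tensors T) ↔
      ∀ A B : T.Algebra, HasCoequalizer (kappaExt T A.A B.A) (T.free.map (A.a ⊗ₘ B.a)) :=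
  ⟨fun ⟨D⟩ A B => ⟨⟨⟨D.cofork A B, D.isColimit A B⟩⟩⟩,
    fun _ => ⟨⟨fun _ _ => colimit.cocone _, fun _ _ => colimit.isColimit _⟩⟩⟩

end Tensor

namespace Tensors

variable {C : Type u} [Category.{v} C] [MonoidalCategory C] {T : Monad C} [MonoidalMonad T]

/-- The algebra `A ⊠ B`. -/
def box (D : Tensors T) (A B : T.Algebra) : T.Algebra := (D.cofork A B).pt

/-- The coequalizer `q_{A,B} : T(A ⊗ B) ⟶ A ⊠ B`. -/
def q (D : Tensors T) (A B : T.Algebra) : T.free.obj (A.A ⊗ B.A) ⟶ D.box A B :=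
  (D.cofork A B).π

theorem condition (D : Tensors T) (A B : T.Algebra) :
    kappaExt T A.A B.A ≫ D.q A B = T.free.map (A.a ⊗ₘ B.a) ≫ D.q A B :=
  (D.cofork A B).condition

/-- The morphism out of `A ⊠ B` induced by a morphism that coequalizes the defining pair. -/
def desc (D : Tensors T) (A B : T.Algebra) {Z : T.Algebra} (k : T.free.obj (A.A ⊗ B.A) ⟶ Z)
    (hk : kappaExt T A.A B.A ≫ k = T.free.map (A.a ⊗ₘ B.a) ≫ k) : D.box A B ⟶ Z :=
  Cofork.IsColimit.desc (D.isColimit A B) k hk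

theorem q_desc (D : Tensors T) (A B : T.Algebra) {Z : T.Algebra}
    (k : T.free.obj (A.A ⊗ B.A) ⟶ Z)
    (hk : kappaExt T A.A B.A ≫ k = T.free.map (A.a ⊗ₘ B.a) ≫ k) :
    D.q A B ≫ D.desc A B k hk = k :=
  Cofork.IsColimit.π_desc' (D.isColimit A B) k hk

theorem hom_ext (D : Tensors T) (A B : T.Algebra) {Z : T.Algebra} {f g : D.box A B ⟶ Z}
    (h : D.q A B ≫ f = D.q A B ≫ g) : f = g :=
  Cofork.IsColimit.hom_ext (D.isColimit A B) h

end Tensors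

section Naturality

variable {C : Type u} [Category.{v} C] [MonoidalCategory C] (T : Monad C) [MonoidalMonad T]

theorem kappa_natural {X X' Y Y' : C} (f : X ⟶ X') (g : Y ⟶ Y') :
    (T.map f ⊗ₘ T.map g) ≫ kappa T X' Y' = kappa T X Y ≫ T.map (f ⊗ₘ g) :=
  Functor.LaxMonoidal.μ_natural T.toFunctor f g

theorem kappaExt_f (X Y : C) :
    (kappaExt T X Y).f = T.map (kappa T X Y) ≫ T.μ.app (X ⊗ Y) := rfl

theorem kappaExt_natural {X X' Y Y' : C} (f : X ⟶ X') (g : Y ⟶ Y') :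
    T.free.map (T.map f ⊗ₘ T.map g) ≫ kappaExt T X' Y' =
      kappaExt T X Y ≫ T.free.map (f ⊗ₘ g) := by
  ext
  rw [Monad.Algebra.comp_f, Monad.Algebra.comp_f, kappaExt_f, kappaExt_f]
  change T.map (T.map f ⊗ₘ T.map g) ≫ T.map (kappa T X' Y') ≫ T.μ.app (X' ⊗ Y') =
    (T.map (kappa T X Y) ≫ T.μ.app (X ⊗ Y)) ≫ T.map (f ⊗ₘ g)
  have h := T.μ.naturality (f ⊗ₘ g)
  rw [Functor.comp_map] at h
  rw [← Category.assoc, ← T.map_comp, kappa_natural, T.map_comp, Category.assoc, Category.assoc, h]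

theorem kappaExt_kappaExt (X Y : C) :
    kappaExt T (T.obj X) (T.obj Y) ≫ kappaExt T X Y =
      T.free.map (T.μ.app X ⊗ₘ T.μ.app Y) ≫ kappaExt T X Y := by
  ext
  rw [Monad.Algebra.comp_f, Monad.Algebra.comp_f, kappaExt_f, kappaExt_f]
  change (T.map (kappa T (T.obj X) (T.obj Y)) ≫ T.μ.app (T.obj X ⊗ T.obj Y)) ≫
      T.map (kappa T X Y) ≫ T.μ.app (X ⊗ Y) =
    T.map (T.μ.app X ⊗ₘ T.μ.app Y) ≫ T.map (kappa T X Y) ≫ T.μ.app (X ⊗ Y)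
  have h := T.μ.naturality (kappa T X Y)
  rw [Functor.comp_map] at h
  have h2 : kappa T (T.obj X) (T.obj Y) ≫ T.map (kappa T X Y) ≫ T.μ.app (X ⊗ Y) =
      (T.μ.app X ⊗ₘ T.μ.app Y) ≫ kappa T X Y := tensor_mul X Y
  rw [← Category.assoc (T.map (T.μ.app X ⊗ₘ T.μ.app Y)), ← T.map_comp, ← h2, T.map_comp,
    T.map_comp]
  simp only [Category.assoc]
  rw [T.assoc, reassoc_of% h]

theorem map_unit_kappaExt (X Y : C) :
    T.free.map (T.η.app X ⊗ₘ T.η.app Y) ≫ kappaExt T X Y = 𝟙 _ := by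
  ext
  rw [Monad.Algebra.comp_f, kappaExt_f]
  change T.map (T.η.app X ⊗ₘ T.η.app Y) ≫ T.map (kappa T X Y) ≫ T.μ.app (X ⊗ Y) = 𝟙 _
  have h2 : (T.η.app X ⊗ₘ T.η.app Y) ≫ kappa T X Y = T.η.app (X ⊗ Y) := tensor_unit X Y
  rw [← Category.assoc, ← T.map_comp, h2]
  exact T.right_unit (X ⊗ Y)

end Naturality

namespace Tensors

variable {C : Type u} [Category.{v} C] [MonoidalCategory C] {T : Monad C} [MonoidalMonad T]

/-- The morphism `g ⊠ h`, determined by `(g ⊠ h) · q = q · T(g ⊗ h)`. -/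
def map (D : Tensors T) {A A' B B' : T.Algebra} (g : A ⟶ A') (h : B ⟶ B') :
    D.box A B ⟶ D.box A' B' :=
  D.desc A B (T.free.map (g.f ⊗ₘ h.f) ≫ D.q A' B') (by
    have hg : (A.a ⊗ₘ B.a) ≫ (g.f ⊗ₘ h.f) =
        (T.map g.f ⊗ₘ T.map h.f) ≫ (A'.a ⊗ₘ B'.a) := by
      rw [tensorHom_comp_tensorHom, tensorHom_comp_tensorHom, g.h, h.h]
    rw [← Category.assoc, ← kappaExt_natural, Category.assoc, condition, ← Category.assoc,
      ← Category.assoc, ← T.free.map_comp, ← T.free.map_comp, hg])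

theorem q_map (D : Tensors T) {A A' B B' : T.Algebra} (g : A ⟶ A') (h : B ⟶ B') :
    D.q A B ≫ D.map g h = T.free.map (g.f ⊗ₘ h.f) ≫ D.q A' B' :=
  D.q_desc A B _ _

/-- The coequalizer `q_{TX,TY} : T(TX ⊗ TY) ⟶ TX ⊠ TY`, for free algebras. -/
def qFree (D : Tensors T) (X Y : C) :
    T.free.obj (T.obj X ⊗ T.obj Y) ⟶ D.box (T.free.obj X) (T.free.obj Y) :=
  D.q (T.free.obj X) (T.free.obj Y)

theorem qFree_condition (D : Tensors T) (X Y : C) :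
    kappaExt T (T.obj X) (T.obj Y) ≫ D.qFree X Y =
      T.free.map (T.μ.app X ⊗ₘ T.μ.app Y) ≫ D.qFree X Y :=
  D.condition (T.free.obj X) (T.free.obj Y)

/-- The morphism `TX ⊠ TY ⟶ T(X ⊗ Y)` induced by `μ · Tκ_{X,Y}`. -/
def freeHom (D : Tensors T) (X Y : C) :
    D.box (T.free.obj X) (T.free.obj Y) ⟶ T.free.obj (X ⊗ Y) :=
  D.desc (T.free.obj X) (T.free.obj Y) (kappaExt T X Y) (kappaExt_kappaExt T X Y)

theorem qFree_freeHom (D : Tensors T) (X Y : C) :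
    D.qFree X Y ≫ D.freeHom X Y = kappaExt T X Y :=
  D.q_desc (T.free.obj X) (T.free.obj Y) (kappaExt T X Y) (kappaExt_kappaExt T X Y)

/-- The canonical isomorphism `TX ⊠ TY ≅ T(X ⊗ Y)`, determined by the fact that
`μ · Tκ_{X,Y} : T(TX ⊗ TY) ⟶ T(X ⊗ Y)` factors as `q_{TX,TY}` followed by it. -/
def freeIso (D : Tensors T) (X Y : C) :
    D.box (T.free.obj X) (T.free.obj Y) ≅ T.free.obj (X ⊗ Y) where
  hom := D.freeHom X Y
  inv := T.free.map (T.η.app X ⊗ₘ T.η.app Y) ≫ D.qFree X Y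
  hom_inv_id := by
    have h : D.qFree X Y ≫ D.freeHom X Y ≫ T.free.map (T.η.app X ⊗ₘ T.η.app Y) ≫ D.qFree X Y =
        D.qFree X Y ≫ 𝟙 _ := by
      rw [← Category.assoc, qFree_freeHom, ← Category.assoc]
      refine (congrArg (· ≫ D.qFree X Y)
        (kappaExt_natural T (T.η.app X) (T.η.app Y)).symm).trans ?_
      refine (Category.assoc _ _ _).trans ?_
      refine (congrArg (T.free.map (T.map (T.η.app X) ⊗ₘ T.map (T.η.app Y)) ≫ ·)
        (D.qFree_condition X Y)).trans ?_
      refine (Category.assoc _ _ _).symm.trans ?_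
      refine (congrArg (· ≫ D.qFree X Y) (map_unit_mul T X Y)).trans ?_
      rw [Category.comp_id]
      exact Category.id_comp _
    exact D.hom_ext (T.free.obj X) (T.free.obj Y) h
  inv_hom_id :=
    (Category.assoc _ _ _).trans
      ((congrArg (T.free.map (T.η.app X ⊗ₘ T.η.app Y) ≫ ·) (D.qFree_freeHom X Y)).trans
        (map_unit_kappaExt T X Y))

/-- Candidates for the structure isomorphisms of a monoidal structure on the category of algebras
with tensor product `⊠` and unit `TE`. -/
structure StructureIsos (D : Tensors T) where
  assoc (A B K : T.Algebra) : D.box (D.box A B) K ≅ D.box A (D.box B K)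
  left (A : T.Algebra) : D.box (T.free.obj (𝟙_ C)) A ≅ A
  right (A : T.Algebra) : D.box A (T.free.obj (𝟙_ C)) ≅ A

/-- The structure isomorphisms are induced by those of `C`: the squares
* `ᾱ · (q_{A,B} ⊠ k) = (a ⊠ q_{B,K}) · Tα`, where `T(A ⊗ B) ⊠ TK` and `TA ⊠ T(B ⊗ K)` are
  identified with `T((A ⊗ B) ⊗ K)` and `T(A ⊗ (B ⊗ K))`,
* `lbar · q_{TE,A} = a · T(a · Tλ · κ · (1 ⊗ η))`,
* `rbar · q_{A,TE} = a · T(a · Tρ · κ · (η ⊗ 1))`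
commute. -/
structure StructureIsos.IsInduced {D : Tensors T} (S : D.StructureIsos) : Prop where
  assoc (A B K : T.Algebra) :
    ((D.freeIso (A.A ⊗ B.A) K.A).inv ≫ D.map (D.q A B) (str T K)) ≫ (S.assoc A B K).hom =
      T.free.map (α_ A.A B.A K.A).hom ≫
        ((D.freeIso A.A (B.A ⊗ K.A)).inv ≫ D.map (str T A) (D.q B K))
  left (A : T.Algebra) :
    D.q (T.free.obj (𝟙_ C)) A ≫ (S.left A).hom =
      extend T A (T.obj (𝟙_ C) ◁ T.η.app A.A ≫ kappa T (𝟙_ C) A.A ≫ T.map (λ_ A.A).hom ≫ A.a)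
  right (A : T.Algebra) :
    D.q A (T.free.obj (𝟙_ C)) ≫ (S.right A).hom =
      extend T A (T.η.app A.A ▷ T.obj (𝟙_ C) ≫ kappa T A.A (𝟙_ C) ≫ T.map (ρ_ A.A).hom ≫ A.a)

/-- The data (without the axioms) of a monoidal structure on the category of algebras given by
the tensor product `⊠` of algebras and of their morphisms, the unit `TE`, and `S`. -/
@[reducible] def StructureIsos.toStruct {D : Tensors T} (S : D.StructureIsos) :
    MonoidalCategoryStruct T.Algebra where
  tensorObj A B := D.box A B
  whiskerLeft A _ _ h := D.map (𝟙 A) h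
  whiskerRight g B := D.map g (𝟙 B)
  tensorHom g h := D.map g h
  tensorUnit := T.free.obj (𝟙_ C)
  associator := S.assoc
  leftUnitor := S.left
  rightUnitor := S.right

end Tensors

end MonoidalMonad

/-! A morphism of algebras out of `A ⊠ B` is the same as a bilinear morphism out of `A ⊗ B`, and
bilinearity amounts to linearity in each variable separately, expressed by the two strengths
`strengthLeft` and `strengthRight` cut out of `κ`. Both ways of combining the strengths give `κ`
back (`strengthLeft_strengthRight`, `strengthRight_strengthLeft`); this replaces any compatibility
of `κ` with the symmetry.

The difficulty is associativity: the universal property of `A ⊠ B` must survive tensoring with a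
further object `K`. Tensoring with `K` has a right adjoint `G` and, by the strength, a distributive
law over `T`. Hence `G Z` is an algebra whenever `Z` is, and morphisms into `Z` that are linear
along the distributive law transpose to morphisms of algebras into `G Z`
(`Distributor.isLinear_iff`). So `linear_ext` and `exists_linear` follow from the universal property
of `A ⊠ B` itself. The symmetry of `C` serves only to give `- ⊗ K` a right adjoint.

Consequently `(A ⊠ B) ⊠ K` and `A ⊠ (B ⊠ K)` both classify trilinear morphisms, and `α` induces the
isomorphism between them. The unitors are extensions of `λ` and `ρ` along the free algebra `TE`,
with explicit inverses built from `η_E`. All coherence laws are tested after precomposition with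
universal multilinear morphisms, where they reduce to those of `C` and to the axioms of `κ`. -/

namespace MonoidalMonad

/-! ### Distributive laws over `T` and algebra structures on right adjoints -/

section Strengths

variable {C : Type u} [Category.{v} C] (T : Monad C)

/-- A functor `F` with a distributive law `F T ⟶ T F` over the monad `T`. -/
structure Distributor (F : C ⥤ C) where
  app (X : C) : F.obj (T.obj X) ⟶ T.obj (F.obj X)
  naturality {X Y : C} (f : X ⟶ Y) : F.map (T.map f) ≫ app Y = app X ≫ T.map (F.map f)
  unit (X : C) : F.map (T.η.app X) ≫ app X = T.η.app (F.obj X)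
  mul (X : C) : F.map (T.μ.app X) ≫ app X = app (T.obj X) ≫ T.map (app X) ≫ T.μ.app (F.obj X)

namespace Distributor

variable {T}

/-- Distributive laws compose. -/
def comp {F G : C ⥤ C} (s : Distributor T F) (t : Distributor T G) :
    Distributor T (F ⋙ G) where
  app X := G.map (s.app X) ≫ t.app (F.obj X)
  naturality f := by
    simp only [Functor.comp_map]
    rw [← G.map_comp_assoc, s.naturality, G.map_comp_assoc, t.naturality, Category.assoc]
  unit X := by
    simp only [Functor.comp_map, Functor.comp_obj]
    rw [← G.map_comp_assoc, s.unit, t.unit]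
  mul X := by
    simp only [Functor.comp_map, Functor.comp_obj]
    rw [← G.map_comp_assoc, s.mul, G.map_comp_assoc, G.map_comp_assoc, t.mul, T.map_comp,
      reassoc_of% t.naturality]
    simp only [Category.assoc]

/-- A morphism `F X ⟶ Z`, for algebras `X` and `Z`, that is linear along a distributive law. -/
def IsLinear {F : C ⥤ C} (s : Distributor T F) {X Z : T.Algebra} (g : F.obj X.A ⟶ Z.A) : Prop :=
  s.app X.A ≫ T.map g ≫ Z.a = F.map X.a ≫ g

/-- Serves to tensor with two objects in succession, as the pentagon requires. -/
theorem IsLinear.comp {F G : C ⥤ C} {s : Distributor T F} {t : Distributor T G}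
    {X Y Z : T.Algebra} {f : F.obj X.A ⟶ Y.A} (hf : s.IsLinear f) {g : G.obj Y.A ⟶ Z.A}
    (hg : t.IsLinear g) : (s.comp t).IsLinear (X := X) (Z := Z) (G.map f ≫ g) := by
  unfold IsLinear at *
  change (G.map (s.app X.A) ≫ t.app (F.obj X.A)) ≫ T.map (G.map f ≫ g) ≫ Z.a =
    G.map (F.map X.a) ≫ G.map f ≫ g
  simp only [T.map_comp, Category.assoc]
  rw [← reassoc_of% t.naturality, hg, ← G.map_comp_assoc, ← G.map_comp_assoc, ← G.map_comp_assoc,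
    Category.assoc, hf]

section Adjoint

variable {F G : C ⥤ C} (s : Distributor T F) (adj : F ⊣ G)

/-- The second factor on the left is the future structure map of `G Z`. Associativity of that
algebra and the description of its morphisms both reduce to this computation. -/
theorem homEquiv_map_comp {X : C} {Z : T.Algebra} (f : F.obj X ⟶ Z.A) :
    T.map (adj.homEquiv X Z.A f) ≫
      adj.homEquiv _ _ (s.app (G.obj Z.A) ≫ T.map (adj.counit.app Z.A) ≫ Z.a) =
    adj.homEquiv _ _ (s.app X ≫ T.map f ≫ Z.a) := by
  rw [← adj.homEquiv_naturality_left, reassoc_of% s.naturality, ← T.map_comp_assoc,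
    ← adj.homEquiv_counit (g := adj.homEquiv X Z.A f), Equiv.symm_apply_apply]

/-- The algebra structure on `G Z`, for a right adjoint `G` of `F`. -/
def rightAdjointObj (Z : T.Algebra) : T.Algebra where
  A := G.obj Z.A
  a := adj.homEquiv _ _ (s.app (G.obj Z.A) ≫ T.map (adj.counit.app Z.A) ≫ Z.a)
  unit := by
    have h : adj.counit.app Z.A ≫ T.η.app Z.A =
        T.η.app (F.obj (G.obj Z.A)) ≫ T.map (adj.counit.app Z.A) :=
      T.η.naturality (adj.counit.app Z.A)
    have h' := s.unit (G.obj Z.A)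
    -- Transposed back along the adjunction, the unit law follows from the unit laws of the
    -- distributive law and of `Z`.
    rw [← adj.homEquiv_naturality_left, ← Equiv.eq_symm_apply, adj.homEquiv_counit]
    refine Eq.trans ?_ (congrArg (· ≫ adj.counit.app Z.A) (F.map_id (G.obj Z.A))).symm
    refine (reassoc_of% h') (T.map (adj.counit.app Z.A) ≫ Z.a) |>.trans ?_
    rw [← reassoc_of% h, Z.unit]
    exact (Category.comp_id _).trans (Category.id_comp _).symm
  assoc := by
    have h : T.map (T.map (adj.counit.app Z.A)) ≫ T.μ.app Z.A =
        T.μ.app (F.obj (G.obj Z.A)) ≫ T.map (adj.counit.app Z.A) :=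
      T.μ.naturality (adj.counit.app Z.A)
    rw [homEquiv_map_comp, ← adj.homEquiv_naturality_left, reassoc_of% s.mul, ← reassoc_of% h,
      Z.assoc]
    simp only [T.map_comp, Category.assoc]
    rfl

theorem isLinear_iff {X Z : T.Algebra} (g : F.obj X.A ⟶ Z.A) :
    s.IsLinear g ↔
      T.map (adj.homEquiv _ _ g) ≫ (s.rightAdjointObj adj Z).a = X.a ≫ adj.homEquiv _ _ g := by
  change _ ↔ T.map (adj.homEquiv _ _ g) ≫
    adj.homEquiv _ _ (s.app (G.obj Z.A) ≫ T.map (adj.counit.app Z.A) ≫ Z.a) = _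
  rw [homEquiv_map_comp, ← adj.homEquiv_naturality_left]
  exact (adj.homEquiv _ _).apply_eq_iff_eq.symm

end Adjoint

end Distributor

end Strengths

/-! ### The two strengths of a monoidal monad -/

section MonoidalStrengths

variable {C : Type u} [Category.{v} C] [MonoidalCategory C] (T : Monad C) [MonoidalMonad T]

theorem kappa_natural_left {X X' : C} (f : X ⟶ X') (Y : C) :
    T.map f ▷ T.obj Y ≫ kappa T X' Y = kappa T X Y ≫ T.map (f ▷ Y) :=
  Functor.LaxMonoidal.μ_natural_left T.toFunctor f Y

theorem kappa_natural_right {Y Y' : C} (X : C) (g : Y ⟶ Y') :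
    T.obj X ◁ T.map g ≫ kappa T X Y' = kappa T X Y ≫ T.map (X ◁ g) :=
  Functor.LaxMonoidal.μ_natural_right T.toFunctor X g

theorem kappa_assoc (X Y Z : C) :
    kappa T X Y ▷ T.obj Z ≫ kappa T (X ⊗ Y) Z ≫ T.map (α_ X Y Z).hom =
      (α_ (T.obj X) (T.obj Y) (T.obj Z)).hom ≫ T.obj X ◁ kappa T Y Z ≫ kappa T X (Y ⊗ Z) :=
  Functor.LaxMonoidal.associativity T.toFunctor X Y Z

theorem kappa_mul (X Y : C) :
    kappa T (T.obj X) (T.obj Y) ≫ T.map (kappa T X Y) ≫ T.μ.app (X ⊗ Y) =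
      (T.μ.app X ⊗ₘ T.μ.app Y) ≫ kappa T X Y :=
  tensor_mul X Y

theorem kappa_unit (X Y : C) : (T.η.app X ⊗ₘ T.η.app Y) ≫ kappa T X Y = T.η.app (X ⊗ Y) :=
  tensor_unit X Y

/-- The strength `TX ⊗ Y ⟶ T(X ⊗ Y)`. -/
def strengthLeft (X Y : C) : T.obj X ⊗ Y ⟶ T.obj (X ⊗ Y) :=
  T.obj X ◁ T.η.app Y ≫ kappa T X Y

/-- The strength `X ⊗ TY ⟶ T(X ⊗ Y)`. -/
def strengthRight (X Y : C) : X ⊗ T.obj Y ⟶ T.obj (X ⊗ Y) :=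
  T.η.app X ▷ T.obj Y ≫ kappa T X Y

theorem strengthLeft_natural {X X' Y Y' : C} (f : X ⟶ X') (g : Y ⟶ Y') :
    (T.map f ⊗ₘ g) ≫ strengthLeft T X' Y' = strengthLeft T X Y ≫ T.map (f ⊗ₘ g) := by
  have h : g ≫ T.η.app Y' = T.η.app Y ≫ T.map g := T.η.naturality g
  rw [strengthLeft, strengthLeft, Category.assoc, ← kappa_natural, ← id_tensorHom,
    ← id_tensorHom, tensorHom_comp_tensorHom_assoc, tensorHom_comp_tensorHom_assoc, h,
    Category.id_comp, Category.comp_id]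

theorem strengthRight_natural {X X' Y Y' : C} (f : X ⟶ X') (g : Y ⟶ Y') :
    (f ⊗ₘ T.map g) ≫ strengthRight T X' Y' = strengthRight T X Y ≫ T.map (f ⊗ₘ g) := by
  have h : f ≫ T.η.app X' = T.η.app X ≫ T.map f := T.η.naturality f
  rw [strengthRight, strengthRight, Category.assoc, ← kappa_natural, ← tensorHom_id,
    ← tensorHom_id, tensorHom_comp_tensorHom_assoc, tensorHom_comp_tensorHom_assoc, h,
    Category.id_comp, Category.comp_id]

theorem strengthLeft_natural_left {X X' : C} (f : X ⟶ X') (Y : C) :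
    T.map f ▷ Y ≫ strengthLeft T X' Y = strengthLeft T X Y ≫ T.map (f ▷ Y) := by
  simpa only [tensorHom_id] using strengthLeft_natural T f (𝟙 Y)

theorem strengthLeft_natural_right (X : C) {Y Y' : C} (g : Y ⟶ Y') :
    T.obj X ◁ g ≫ strengthLeft T X Y' = strengthLeft T X Y ≫ T.map (X ◁ g) := by
  have h := strengthLeft_natural T (𝟙 X) g
  rw [T.map_id] at h
  simpa only [id_tensorHom] using h

theorem strengthRight_natural_left {X X' : C} (f : X ⟶ X') (Y : C) :
    f ▷ T.obj Y ≫ strengthRight T X' Y = strengthRight T X Y ≫ T.map (f ▷ Y) := by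
  have h := strengthRight_natural T f (𝟙 Y)
  rw [T.map_id] at h
  simpa only [tensorHom_id] using h

theorem strengthRight_natural_right (X : C) {Y Y' : C} (g : Y ⟶ Y') :
    X ◁ T.map g ≫ strengthRight T X Y' = strengthRight T X Y ≫ T.map (X ◁ g) := by
  simpa only [id_tensorHom] using strengthRight_natural T (𝟙 X) g

theorem unit_strengthLeft (X Y : C) :
    T.η.app X ▷ Y ≫ strengthLeft T X Y = T.η.app (X ⊗ Y) := by
  rw [strengthLeft, ← kappa_unit, MonoidalCategory.tensorHom_def, Category.assoc]
  rfl

theorem unit_strengthRight (X Y : C) :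
    X ◁ T.η.app Y ≫ strengthRight T X Y = T.η.app (X ⊗ Y) := by
  rw [strengthRight, ← kappa_unit, tensorHom_def', Category.assoc]
  rfl

/-- By naturality `κ` moves past the inserted units, and its compatibility with `μ` then cancels
them. With its mirror image below, this says that the two strengths commute. -/
theorem strengthLeft_strengthRight (X Y : C) :
    strengthLeft T X (T.obj Y) ≫ T.map (strengthRight T X Y) ≫ T.μ.app (X ⊗ Y) =
      kappa T X Y := by
  rw [strengthLeft, strengthRight, T.map_comp, Category.assoc, Category.assoc,
    ← reassoc_of% kappa_natural_left, kappa_mul, ← id_tensorHom, ← tensorHom_id,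
    tensorHom_comp_tensorHom_assoc, tensorHom_comp_tensorHom_assoc]
  simp [T.left_unit, T.right_unit]

theorem strengthRight_strengthLeft (X Y : C) :
    strengthRight T (T.obj X) Y ≫ T.map (strengthLeft T X Y) ≫ T.μ.app (X ⊗ Y) =
      kappa T X Y := by
  rw [strengthLeft, strengthRight, T.map_comp, Category.assoc, Category.assoc,
    ← reassoc_of% kappa_natural_right, kappa_mul, ← id_tensorHom, ← tensorHom_id,
    tensorHom_comp_tensorHom_assoc, tensorHom_comp_tensorHom_assoc]
  simp [T.left_unit, T.right_unit]

/-- Tensoring on the right with `K` distributes over `T`. -/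
def distributorRight (K : C) : Distributor T (tensorRight K) where
  app X := strengthLeft T X K
  naturality f := strengthLeft_natural_left T f K
  unit X := unit_strengthLeft T X K
  mul X := by
    change T.μ.app X ▷ K ≫ strengthLeft T X K =
      strengthLeft T (T.obj X) K ≫ T.map (strengthLeft T X K) ≫ T.μ.app (X ⊗ K)
    simp only [strengthLeft, T.map_comp, Category.assoc]
    rw [← reassoc_of% kappa_natural_right, kappa_mul, ← id_tensorHom, ← id_tensorHom,
      ← id_tensorHom, ← tensorHom_id, tensorHom_comp_tensorHom_assoc,
      tensorHom_comp_tensorHom_assoc, tensorHom_comp_tensorHom_assoc]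
    simp [T.right_unit]

/-- Tensoring on the left with `K` distributes over `T`. -/
def distributorLeft (K : C) : Distributor T (tensorLeft K) where
  app X := strengthRight T K X
  naturality f := strengthRight_natural_right T K f
  unit X := unit_strengthRight T K X
  mul X := by
    change K ◁ T.μ.app X ≫ strengthRight T K X =
      strengthRight T K (T.obj X) ≫ T.map (strengthRight T K X) ≫ T.μ.app (K ⊗ X)
    simp only [strengthRight, T.map_comp, Category.assoc]
    rw [← reassoc_of% kappa_natural_left, kappa_mul, ← id_tensorHom, ← tensorHom_id,
      ← tensorHom_id, ← tensorHom_id, tensorHom_comp_tensorHom_assoc,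
      tensorHom_comp_tensorHom_assoc, tensorHom_comp_tensorHom_assoc]
    simp [T.right_unit]

/-- Since `ε = η_E`, this is the unitality axiom of the lax monoidal functor. -/
theorem leftUnitor_inv_strengthRight (X : C) :
    (λ_ (T.obj X)).inv ≫ strengthRight T (𝟙_ C) X = T.map (λ_ X).inv := by
  rw [strengthRight, ← ε_eq_η (T := T)]
  exact Functor.LaxMonoidal.left_unitality_inv T.toFunctor X

theorem rightUnitor_inv_strengthLeft (X : C) :
    (ρ_ (T.obj X)).inv ≫ strengthLeft T X (𝟙_ C) = T.map (ρ_ X).inv := by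
  rw [strengthLeft, ← ε_eq_η (T := T)]
  exact Functor.LaxMonoidal.right_unitality_inv T.toFunctor X

theorem strengthRight_leftUnitor (X : C) :
    strengthRight T (𝟙_ C) X ≫ T.map (λ_ X).hom = (λ_ (T.obj X)).hom := by
  rw [← cancel_epi (λ_ (T.obj X)).inv, reassoc_of% leftUnitor_inv_strengthRight,
    ← T.map_comp]
  simp

theorem strengthLeft_rightUnitor (X : C) :
    strengthLeft T X (𝟙_ C) ≫ T.map (ρ_ X).hom = (ρ_ (T.obj X)).hom := by
  rw [← cancel_epi (ρ_ (T.obj X)).inv, reassoc_of% rightUnitor_inv_strengthLeft,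
    ← T.map_comp]
  simp

end MonoidalStrengths

/-! ### Morphisms out of free algebras -/

section Free

variable {C : Type u} [Category.{v} C] {T : Monad C}

/-- The restriction of a morphism of algebras `TX ⟶ Z` to `X`. -/
def restrict {X : C} {Z : T.Algebra} (g : T.free.obj X ⟶ Z) : X ⟶ Z.A :=
  CategoryStruct.comp (Y := T.obj X) (T.η.app X) g.f

theorem restrict_comp {X : C} {Z W : T.Algebra} (g : T.free.obj X ⟶ Z) (h : Z ⟶ W) :
    restrict (g ≫ h) = restrict g ≫ h.f :=
  (Category.assoc (W := X) (X := T.obj X) (T.η.app X) g.f h.f).symm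

theorem restrict_map_comp {X Y : C} {Z : T.Algebra} (f : X ⟶ Y) (g : T.free.obj Y ⟶ Z) :
    restrict (T.free.map f ≫ g) = f ≫ restrict g := by
  have h : f ≫ T.η.app Y = T.η.app X ≫ T.map f := T.η.naturality f
  exact ((reassoc_of% h) (Z := Z.A) g.f).symm

theorem restrict_extend {X : C} (Z : T.Algebra) (f : X ⟶ Z.A) :
    restrict (extend T Z f) = f := by
  have hZ : T.η.app Z.A ≫ Z.a = 𝟙 Z.A := Z.unit
  rw [extend, restrict_map_comp]
  exact (congrArg (f ≫ ·) hZ).trans (Category.comp_id f)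

theorem extend_restrict {X : C} {Z : T.Algebra} (g : T.free.obj X ⟶ Z) :
    extend T Z (restrict g) = g := by
  ext
  have h : T.map g.f ≫ Z.a = T.μ.app X ≫ g.f := g.h
  have h' : T.map (T.η.app X) ≫ T.μ.app X = 𝟙 _ := T.right_unit X
  refine (congrArg (· ≫ Z.a) (T.map_comp (Y := T.obj X) (T.η.app X) g.f)).trans ?_
  refine (Category.assoc _ _ _).trans ((congrArg (T.map (T.η.app X) ≫ ·) h).trans ?_)
  exact (reassoc_of% h') (Z := Z.A) g.f

theorem restrict_str (A : T.Algebra) : restrict (str T A) = 𝟙 A.A := A.unit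

theorem free_hom_ext {X : C} {Z : T.Algebra} {g h : T.free.obj X ⟶ Z}
    (e : restrict g = restrict h) : g = h := by
  rw [← extend_restrict g, ← extend_restrict h, e]

theorem unit_whiskerRight_str [MonoidalCategory C] (A : T.Algebra) (K : C) :
    T.η.app A.A ▷ K ≫ A.a ▷ K = 𝟙 (A.A ⊗ K) := by
  have h : T.η.app A.A ≫ A.a = 𝟙 A.A := A.unit
  exact (comp_whiskerRight _ _ K).symm.trans ((congrArg (· ▷ K) h).trans (id_whiskerRight _ _))

theorem whiskerLeft_unit_str [MonoidalCategory C] (A : T.Algebra) (K : C) :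
    K ◁ T.η.app A.A ≫ K ◁ A.a = 𝟙 (K ⊗ A.A) := by
  have h : T.η.app A.A ≫ A.a = 𝟙 A.A := A.unit
  exact (whiskerLeft_comp K _ _).symm.trans ((congrArg (K ◁ ·) h).trans (whiskerLeft_id _ _))

theorem unit_tensorHom_str [MonoidalCategory C] (A B : T.Algebra) :
    (T.η.app A.A ⊗ₘ T.η.app B.A) ≫ (A.a ⊗ₘ B.a) = 𝟙 (A.A ⊗ B.A) := by
  have hA : T.η.app A.A ≫ A.a = 𝟙 A.A := A.unit
  have hB : T.η.app B.A ≫ B.a = 𝟙 B.A := B.unit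
  refine (tensorHom_comp_tensorHom _ _ _ _).trans ?_
  exact (congrArg₂ (· ⊗ₘ ·) hA hB).trans (id_tensorHom_id _ _)

end Free

/-! ### Bilinear morphisms -/

section Multilinear

variable {C : Type u} [Category.{v} C] [MonoidalCategory C] {T : Monad C} [MonoidalMonad T]

/-- Morphisms `A ⊗ B ⟶ Z` that are linear in both variables. -/
def IsBilinear {A B Z : T.Algebra} (f : A.A ⊗ B.A ⟶ Z.A) : Prop :=
  kappa T A.A B.A ≫ T.map f ≫ Z.a = (A.a ⊗ₘ B.a) ≫ f

theorem isLinear_left_iff {X Z : T.Algebra} {K : C} (g : X.A ⊗ K ⟶ Z.A) :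
    (distributorRight T K).IsLinear (X := X) (Z := Z) g ↔
      strengthLeft T X.A K ≫ T.map g ≫ Z.a = X.a ▷ K ≫ g :=
  Iff.rfl

theorem isLinear_right_iff {X Z : T.Algebra} {K : C} (g : K ⊗ X.A ⟶ Z.A) :
    (distributorLeft T K).IsLinear (X := X) (Z := Z) g ↔
      strengthRight T K X.A ≫ T.map g ≫ Z.a = K ◁ X.a ≫ g :=
  Iff.rfl

variable {A B Z : T.Algebra} {f : A.A ⊗ B.A ⟶ Z.A}

theorem IsBilinear.left (hf : IsBilinear f) :
    strengthLeft T A.A B.A ≫ T.map f ≫ Z.a = A.a ▷ B.A ≫ f := by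
  unfold IsBilinear at hf
  rw [strengthLeft, Category.assoc, hf, tensorHom_def', Category.assoc,
    reassoc_of% whiskerLeft_unit_str]

theorem IsBilinear.right (hf : IsBilinear f) :
    strengthRight T A.A B.A ≫ T.map f ≫ Z.a = A.A ◁ B.a ≫ f := by
  unfold IsBilinear at hf
  rw [strengthRight, Category.assoc, hf, MonoidalCategory.tensorHom_def, Category.assoc,
    reassoc_of% unit_whiskerRight_str]

/-- Writing `κ` as a composite of the two strengths lets the variables be treated one at a time. -/
theorem isBilinear_of_left_of_right
    (hl : strengthLeft T A.A B.A ≫ T.map f ≫ Z.a = A.a ▷ B.A ≫ f)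
    (hr : strengthRight T A.A B.A ≫ T.map f ≫ Z.a = A.A ◁ B.a ≫ f) : IsBilinear f := by
  have h : T.map (T.map f) ≫ T.μ.app Z.A = T.μ.app (A.A ⊗ B.A) ≫ T.map f := T.μ.naturality f
  unfold IsBilinear
  rw [← strengthLeft_strengthRight, Category.assoc, Category.assoc, ← reassoc_of% h, Z.assoc,
    ← T.map_comp_assoc, ← T.map_comp_assoc, Category.assoc, hr, T.map_comp, Category.assoc,
    ← reassoc_of% strengthLeft_natural_right, hl, tensorHom_def', Category.assoc]

theorem IsBilinear.comp_hom {W : T.Algebra} (hf : IsBilinear f) (h : Z ⟶ W) :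
    IsBilinear (Z := W) (f ≫ h.f) := by
  unfold IsBilinear at *
  rw [T.map_comp, Category.assoc, h.h, reassoc_of% hf]

theorem kappa_map_comp {X Y : C} {Z : T.Algebra} (f : X ⊗ Y ⟶ Z.A) :
    (kappaExt T X Y ≫ extend T Z f).f =
      T.map (kappa T X Y ≫ T.map f ≫ Z.a) ≫ Z.a := by
  have h : T.map (T.map f) ≫ T.μ.app Z.A = T.μ.app (X ⊗ Y) ≫ T.map f := T.μ.naturality f
  change (T.map (kappa T X Y) ≫ T.μ.app (X ⊗ Y)) ≫ T.map f ≫ Z.a = _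
  rw [Category.assoc, ← reassoc_of% h, Z.assoc]
  simp only [T.map_comp, Category.assoc]

/-- Both composites are morphisms out of a free algebra, so they may be compared on generators. This
turns the coequalizer into a universal bilinear morphism. -/
theorem kappaExt_extend_eq_iff :
    kappaExt T A.A B.A ≫ extend T Z f = T.free.map (A.a ⊗ₘ B.a) ≫ extend T Z f ↔
      IsBilinear f := by
  have h : T.free.map (A.a ⊗ₘ B.a) ≫ extend T Z f = extend T Z ((A.a ⊗ₘ B.a) ≫ f) := by
    rw [extend, extend, T.free.map_comp, Category.assoc]
  have h' : kappaExt T A.A B.A ≫ extend T Z f =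
      extend T Z (kappa T A.A B.A ≫ T.map f ≫ Z.a) := by
    ext
    exact kappa_map_comp f
  rw [h, h']
  refine ⟨fun e => ?_, fun e => congrArg _ e⟩
  have e' := congrArg restrict e
  rwa [restrict_extend, restrict_extend] at e'

end Multilinear

/-! ### The universal property of `⊠`, and its persistence under left adjoints -/

namespace Tensors

variable {C : Type u} [Category.{v} C] [MonoidalCategory C] {T : Monad C} [MonoidalMonad T]

/-- The universal bilinear morphism `A ⊗ B ⟶ A ⊠ B`. -/
def univ (D : Tensors T) (A B : T.Algebra) : A.A ⊗ B.A ⟶ (D.box A B).A :=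
  restrict (D.q A B)

theorem extend_univ (D : Tensors T) (A B : T.Algebra) : extend T _ (D.univ A B) = D.q A B :=
  extend_restrict _

theorem univ_isBilinear (D : Tensors T) (A B : T.Algebra) : IsBilinear (D.univ A B) := by
  rw [← kappaExt_extend_eq_iff, extend_univ]
  exact D.condition A B

theorem box_hom_ext (D : Tensors T) {A B Z : T.Algebra} {g h : D.box A B ⟶ Z}
    (e : D.univ A B ≫ g.f = D.univ A B ≫ h.f) : g = h := by
  refine D.hom_ext A B (free_hom_ext ?_)
  rw [restrict_comp, restrict_comp]
  exact e

/-- The morphism of algebras induced by a bilinear morphism. -/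
def lift (D : Tensors T) {A B Z : T.Algebra} (f : A.A ⊗ B.A ⟶ Z.A) (hf : IsBilinear f) :
    D.box A B ⟶ Z :=
  D.desc A B (extend T Z f) (kappaExt_extend_eq_iff.2 hf)

theorem univ_lift (D : Tensors T) {A B Z : T.Algebra} (f : A.A ⊗ B.A ⟶ Z.A)
    (hf : IsBilinear f) : D.univ A B ≫ (D.lift f hf).f = f := by
  rw [univ, ← restrict_comp, lift, q_desc, restrict_extend]

theorem univ_map (D : Tensors T) {A A' B B' : T.Algebra} (g : A ⟶ A') (h : B ⟶ B') :
    D.univ A B ≫ (D.map g h).f = (g.f ⊗ₘ h.f) ≫ D.univ A' B' := by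
  rw [univ, ← restrict_comp, q_map, restrict_map_comp, univ]

theorem univ_map_id_left (D : Tensors T) (A : T.Algebra) {B B' : T.Algebra} (h : B ⟶ B') :
    D.univ A B ≫ (D.map (𝟙 A) h).f = A.A ◁ h.f ≫ D.univ A B' := by
  rw [univ_map, Monad.Algebra.id_f, id_tensorHom]

theorem univ_map_id_right (D : Tensors T) {A A' : T.Algebra} (g : A ⟶ A') (B : T.Algebra) :
    D.univ A B ≫ (D.map g (𝟙 B)).f = g.f ▷ B.A ≫ D.univ A' B := by
  rw [univ_map, Monad.Algebra.id_f, tensorHom_id]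

theorem univ_comp_isLinear_left (D : Tensors T) {A B Z : T.Algebra} {g : D.box A B ⟶ Z} :
    (distributorRight T B.A).IsLinear (X := A) (Z := Z) (D.univ A B ≫ g.f) :=
  ((D.univ_isBilinear A B).comp_hom g).left

theorem univ_comp_isLinear_right (D : Tensors T) {A B Z : T.Algebra} {g : D.box A B ⟶ Z} :
    (distributorLeft T A.A).IsLinear (X := B) (Z := Z) (D.univ A B ≫ g.f) :=
  ((D.univ_isBilinear A B).comp_hom g).right

section Adjoint

variable (D : Tensors T) {F G : C ⥤ C} (s : Distributor T F) {A B Z : T.Algebra}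

/-- If `F` is a left adjoint, linear morphisms out of `F (A ⊠ B)` are determined on `F (A ⊗ B)`. -/
theorem linear_ext (adj : F ⊣ G) {g h : F.obj (D.box A B).A ⟶ Z.A}
    (hg : s.IsLinear g) (hh : s.IsLinear h)
    (e : F.map (D.univ A B) ≫ g = F.map (D.univ A B) ≫ h) : g = h := by
  rw [s.isLinear_iff adj] at hg hh
  -- The transposes are morphisms of algebras out of `A ⊠ B`, so they are determined by their
  -- composites with `univ`.
  let g' : D.box A B ⟶ s.rightAdjointObj adj Z := ⟨adj.homEquiv _ _ g, hg⟩
  let h' : D.box A B ⟶ s.rightAdjointObj adj Z := ⟨adj.homEquiv _ _ h, hh⟩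
  have e' : g' = h' := D.box_hom_ext (by
    change D.univ A B ≫ adj.homEquiv _ _ g = D.univ A B ≫ adj.homEquiv _ _ h
    rw [← adj.homEquiv_naturality_left, ← adj.homEquiv_naturality_left, e])
  exact (adj.homEquiv _ _).injective (congrArg Monad.Algebra.Hom.f e')

/-- Bilinear morphisms out of `F (A ⊗ B)` extend to `F (A ⊠ B)` if `F` is a left adjoint. -/
theorem exists_linear (adj : F ⊣ G) (f : F.obj (A.A ⊗ B.A) ⟶ Z.A)
    (hf : F.map (kappa T A.A B.A) ≫ s.app _ ≫ T.map f ≫ Z.a = F.map (A.a ⊗ₘ B.a) ≫ f) :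
    ∃ g : F.obj (D.box A B).A ⟶ Z.A, s.IsLinear g ∧ F.map (D.univ A B) ≫ g = f := by
  -- Transposition turns the hypothesis on `f` into bilinearity with values in the algebra `G Z`.
  have hb : IsBilinear (Z := s.rightAdjointObj adj Z) (adj.homEquiv (A.A ⊗ B.A) Z.A f) := by
    change kappa T A.A B.A ≫ T.map (adj.homEquiv _ _ f) ≫
      adj.homEquiv _ _ (s.app (G.obj Z.A) ≫ T.map (adj.counit.app Z.A) ≫ Z.a) = _
    rw [Distributor.homEquiv_map_comp, ← adj.homEquiv_naturality_left, hf,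
      adj.homEquiv_naturality_left]
    rfl
  let k := D.lift _ hb
  have hk : adj.homEquiv (D.box A B).A Z.A ((adj.homEquiv (D.box A B).A Z.A).symm k.f) = k.f :=
    Equiv.apply_symm_apply _ _
  refine ⟨(adj.homEquiv _ _).symm k.f, ?_, ?_⟩
  · rw [s.isLinear_iff adj, hk]
    exact k.h
  · apply (adj.homEquiv _ _).injective
    rw [adj.homEquiv_naturality_left, hk]
    exact D.univ_lift _ hb

end Adjoint

theorem whiskerLeft_univ_ext [MonoidalClosed C] (D : Tensors T) {A B Z : T.Algebra} (L : C)
    {g h : L ⊗ (D.box A B).A ⟶ Z.A}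
    (hg : (distributorLeft T L).IsLinear (X := D.box A B) (Z := Z) g)
    (hh : (distributorLeft T L).IsLinear (X := D.box A B) (Z := Z) h)
    (e : L ◁ D.univ A B ≫ g = L ◁ D.univ A B ≫ h) : g = h :=
  D.linear_ext _ (ihom.adjunction L) hg hh e

end Tensors

/-! ### Trilinear morphisms -/

section Trilinear

variable {C : Type u} [Category.{v} C] [MonoidalCategory C] {T : Monad C} [MonoidalMonad T]

/-- Morphisms `(A ⊗ B) ⊗ K ⟶ Z` that are linear in all three variables. -/
def IsTrilinear {A B K Z : T.Algebra} (f : (A.A ⊗ B.A) ⊗ K.A ⟶ Z.A) : Prop :=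
  kappa T A.A B.A ▷ T.obj K.A ≫ kappa T (A.A ⊗ B.A) K.A ≫ T.map f ≫ Z.a =
    ((A.a ⊗ₘ B.a) ⊗ₘ K.a) ≫ f

/-- Morphisms `A ⊗ (B ⊗ K) ⟶ Z` that are linear in all three variables. -/
def IsTrilinear' {A B K Z : T.Algebra} (f : A.A ⊗ B.A ⊗ K.A ⟶ Z.A) : Prop :=
  T.obj A.A ◁ kappa T B.A K.A ≫ kappa T A.A (B.A ⊗ K.A) ≫ T.map f ≫ Z.a =
    (A.a ⊗ₘ B.a ⊗ₘ K.a) ≫ f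

variable {A B K X Z : T.Algebra}

/-- The associativity axiom of `κ` matches the two bracketings. -/
theorem IsTrilinear'.associator_comp {f : A.A ⊗ B.A ⊗ K.A ⟶ Z.A} (hf : IsTrilinear' f) :
    IsTrilinear ((α_ A.A B.A K.A).hom ≫ f) := by
  unfold IsTrilinear' at hf
  unfold IsTrilinear
  have h := kappa_assoc T A.A B.A K.A
  rw [T.map_comp, Category.assoc, reassoc_of% h, hf, associator_naturality_assoc]

theorem IsTrilinear.associator_inv_comp {f : (A.A ⊗ B.A) ⊗ K.A ⟶ Z.A} (hf : IsTrilinear f) :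
    IsTrilinear' ((α_ A.A B.A K.A).inv ≫ f) := by
  unfold IsTrilinear at hf
  unfold IsTrilinear'
  have h := kappa_assoc T A.A B.A K.A
  rw [← cancel_epi (α_ (T.obj A.A) (T.obj B.A) (T.obj K.A)).hom, ← reassoc_of% h,
    ← T.map_comp_assoc, Iso.hom_inv_id_assoc, hf, ← associator_naturality_assoc,
    Iso.hom_inv_id_assoc]

theorem IsBilinear.whiskerRight_comp {f : A.A ⊗ B.A ⟶ X.A} (hf : IsBilinear f)
    {g : X.A ⊗ K.A ⟶ Z.A} (hg : IsBilinear g) : IsTrilinear (f ▷ K.A ≫ g) := by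
  unfold IsBilinear at hf hg
  unfold IsTrilinear
  rw [T.map_comp, Category.assoc, ← reassoc_of% kappa_natural_left, hg,
    ← tensorHom_id, ← tensorHom_id, ← tensorHom_id, tensorHom_comp_tensorHom_assoc,
    tensorHom_comp_tensorHom_assoc, tensorHom_comp_tensorHom_assoc]
  simp only [Category.assoc, Category.id_comp, Category.comp_id]
  rw [hf]

theorem IsBilinear.whiskerLeft_comp {f : B.A ⊗ K.A ⟶ X.A} (hf : IsBilinear f)
    {g : A.A ⊗ X.A ⟶ Z.A} (hg : IsBilinear g) : IsTrilinear' (A.A ◁ f ≫ g) := by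
  unfold IsBilinear at hf hg
  unfold IsTrilinear'
  rw [T.map_comp, Category.assoc, ← reassoc_of% kappa_natural_right, hg,
    ← id_tensorHom, ← id_tensorHom, ← id_tensorHom, tensorHom_comp_tensorHom_assoc,
    tensorHom_comp_tensorHom_assoc, tensorHom_comp_tensorHom_assoc]
  simp only [Category.assoc, Category.id_comp, Category.comp_id]
  rw [hf]

/-- Inserting `η` in the third variable freezes it. The result is the hypothesis of `exists_linear`
for the functor `- ⊗ K`. -/
theorem IsTrilinear.left {f : (A.A ⊗ B.A) ⊗ K.A ⟶ Z.A} (hf : IsTrilinear f) :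
    kappa T A.A B.A ▷ K.A ≫ strengthLeft T (A.A ⊗ B.A) K.A ≫ T.map f ≫ Z.a =
      (A.a ⊗ₘ B.a) ▷ K.A ≫ f := by
  unfold IsTrilinear at hf
  rw [strengthLeft, Category.assoc, ← whisker_exchange_assoc, hf, tensorHom_def',
    Category.assoc, reassoc_of% whiskerLeft_unit_str]

theorem IsTrilinear'.right {f : A.A ⊗ B.A ⊗ K.A ⟶ Z.A} (hf : IsTrilinear' f) :
    A.A ◁ kappa T B.A K.A ≫ strengthRight T A.A (B.A ⊗ K.A) ≫ T.map f ≫ Z.a =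
      A.A ◁ (B.a ⊗ₘ K.a) ≫ f := by
  unfold IsTrilinear' at hf
  rw [strengthRight, Category.assoc, whisker_exchange_assoc, hf,
    MonoidalCategory.tensorHom_def A.a, Category.assoc, reassoc_of% unit_whiskerRight_str]

theorem IsTrilinear.right {f : (A.A ⊗ B.A) ⊗ K.A ⟶ Z.A} (hf : IsTrilinear f) :
    strengthRight T (A.A ⊗ B.A) K.A ≫ T.map f ≫ Z.a = (A.A ⊗ B.A) ◁ K.a ≫ f := by
  unfold IsTrilinear at hf
  have h := (congrArg (· ▷ T.obj K.A) (unit_tensorHom_str A B)).trans (id_whiskerRight _ _)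
  simp only [comp_whiskerRight] at h
  rw [strengthRight, ← kappa_unit, comp_whiskerRight, Category.assoc, Category.assoc, hf,
    MonoidalCategory.tensorHom_def _ K.a, Category.assoc, reassoc_of% h]

theorem IsTrilinear'.left {f : A.A ⊗ B.A ⊗ K.A ⟶ Z.A} (hf : IsTrilinear' f) :
    strengthLeft T A.A (B.A ⊗ K.A) ≫ T.map f ≫ Z.a = A.a ▷ (B.A ⊗ K.A) ≫ f := by
  unfold IsTrilinear' at hf
  have h := (congrArg (T.obj A.A ◁ ·) (unit_tensorHom_str B K)).trans (whiskerLeft_id _ _)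
  simp only [MonoidalCategory.whiskerLeft_comp] at h
  rw [strengthLeft, ← kappa_unit, MonoidalCategory.whiskerLeft_comp, Category.assoc,
    Category.assoc, hf, tensorHom_def' A.a, Category.assoc, reassoc_of% h]

variable {L : C}

/-- If `g` is linear on the left, then so is the morphism that evaluates it on the free algebra
on its second variable. -/
theorem isLinear_left_strengthRight {g : X.A ⊗ L ⟶ Z.A}
    (hg : strengthLeft T X.A L ≫ T.map g ≫ Z.a = X.a ▷ L ≫ g) :
    strengthLeft T X.A (T.obj L) ≫ T.map (strengthRight T X.A L ≫ T.map g ≫ Z.a) ≫ Z.a =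
      X.a ▷ T.obj L ≫ strengthRight T X.A L ≫ T.map g ≫ Z.a := by
  have h : T.map (T.map g) ≫ T.μ.app Z.A = T.μ.app (X.A ⊗ L) ≫ T.map g := T.μ.naturality g
  rw [reassoc_of% strengthRight_natural_left, ← T.map_comp_assoc, ← hg]
  simp only [T.map_comp, Category.assoc]
  -- Each side applies both strengths, in opposite orders, so each becomes `κ` followed by `T g` and
  -- the structure map.
  rw [← Z.assoc, reassoc_of% h, reassoc_of% strengthLeft_strengthRight,
    reassoc_of% strengthRight_strengthLeft]

theorem isLinear_right_strengthLeft {g : L ⊗ X.A ⟶ Z.A}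
    (hg : strengthRight T L X.A ≫ T.map g ≫ Z.a = L ◁ X.a ≫ g) :
    strengthRight T (T.obj L) X.A ≫ T.map (strengthLeft T L X.A ≫ T.map g ≫ Z.a) ≫ Z.a =
      T.obj L ◁ X.a ≫ strengthLeft T L X.A ≫ T.map g ≫ Z.a := by
  have h : T.map (T.map g) ≫ T.μ.app Z.A = T.μ.app (L ⊗ X.A) ≫ T.map g := T.μ.naturality g
  rw [reassoc_of% strengthLeft_natural_right, ← T.map_comp_assoc, ← hg]
  simp only [T.map_comp, Category.assoc]
  rw [← Z.assoc, reassoc_of% h, reassoc_of% strengthLeft_strengthRight,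
    reassoc_of% strengthRight_strengthLeft]

end Trilinear

/-! ### Iterated tensor products and the associator -/

namespace Tensors

section

variable {C : Type u} [Category.{v} C] [MonoidalCategory C] [MonoidalClosed C] {T : Monad C}
  [MonoidalMonad T] (D : Tensors T) {A B K Z : T.Algebra}

theorem box_box_hom_ext' {g h : D.box A (D.box B K) ⟶ Z}
    (e : A.A ◁ D.univ B K ≫ D.univ A (D.box B K) ≫ g.f =
      A.A ◁ D.univ B K ≫ D.univ A (D.box B K) ≫ h.f) : g = h :=
  D.box_hom_ext (D.whiskerLeft_univ_ext A.A D.univ_comp_isLinear_right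
    D.univ_comp_isLinear_right e)

/-- Trilinear morphisms extend to `A ⊠ (B ⊠ K)`. -/
theorem exists_box_box_hom' (f : A.A ⊗ B.A ⊗ K.A ⟶ Z.A) (hf : IsTrilinear' f) :
    ∃ g : D.box A (D.box B K) ⟶ Z,
      A.A ◁ D.univ B K ≫ D.univ A (D.box B K) ≫ g.f = f := by
  obtain ⟨g, hg, e⟩ := D.exists_linear (distributorLeft T A.A) (ihom.adjunction A.A) f hf.right
  replace e : A.A ◁ D.univ B K ≫ g = f := e
  replace hg : strengthRight T A.A (D.box B K).A ≫ T.map g ≫ Z.a = A.A ◁ (D.box B K).a ≫ g := hg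
  have hb : IsBilinear (A := A) (B := D.box B K) g := by
    refine isBilinear_of_left_of_right ?_ hg
    -- Linearity in `A` is an equation between morphisms `TA ⊗ (B ⊠ K) ⟶ Z`. Both are linear in the
    -- second variable, so it suffices to check it on `TA ⊗ (B ⊗ K)`, where it is the linearity of
    -- `f`.
    refine D.whiskerLeft_univ_ext (T.obj A.A) (isLinear_right_strengthLeft hg) ?_ ?_
    · rw [isLinear_right_iff, T.map_comp, Category.assoc, ← reassoc_of% strengthRight_natural_left,
        hg, ← whisker_exchange_assoc]
    · rw [reassoc_of% strengthLeft_natural_right, ← T.map_comp_assoc, e, hf.left,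
        whisker_exchange_assoc, e]
  exact ⟨D.lift g hb, by rw [univ_lift, e]⟩

end

section

variable {C : Type u} [Category.{v} C] [MonoidalCategory C] [SymmetricCategory C]
  [MonoidalClosed C] {T : Monad C} [MonoidalMonad T]

/-- In a closed symmetric monoidal category, tensoring on the right has a right adjoint. -/
noncomputable def tensorRightAdjunction (K : C) : tensorRight K ⊣ ihom K :=
  (ihom.adjunction K).ofNatIsoLeft (BraidedCategory.tensorLeftIsoTensorRight K)

variable (D : Tensors T) {A B K Z : T.Algebra}

theorem whiskerRight_univ_ext (L : C) {g h : (D.box A B).A ⊗ L ⟶ Z.A}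
    (hg : (distributorRight T L).IsLinear (X := D.box A B) (Z := Z) g)
    (hh : (distributorRight T L).IsLinear (X := D.box A B) (Z := Z) h)
    (e : D.univ A B ▷ L ≫ g = D.univ A B ▷ L ≫ h) : g = h :=
  D.linear_ext _ (tensorRightAdjunction L) hg hh e

theorem box_box_hom_ext {g h : D.box (D.box A B) K ⟶ Z}
    (e : D.univ A B ▷ K.A ≫ D.univ (D.box A B) K ≫ g.f =
      D.univ A B ▷ K.A ≫ D.univ (D.box A B) K ≫ h.f) : g = h :=
  D.box_hom_ext (D.whiskerRight_univ_ext K.A D.univ_comp_isLinear_left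
    D.univ_comp_isLinear_left e)

/-- After the outer two products are resolved, `A ⊠ B` sits under `(- ⊗ K) ⊗ L`, a composite of left
adjoints carrying the composite distributive law, so `linear_ext` applies again. -/
theorem box_box_box_hom_ext {L : T.Algebra} {g h : D.box (D.box (D.box A B) K) L ⟶ Z}
    (e : (D.univ A B ▷ K.A) ▷ L.A ≫ D.univ (D.box A B) K ▷ L.A ≫
        D.univ (D.box (D.box A B) K) L ≫ g.f =
      (D.univ A B ▷ K.A) ▷ L.A ≫ D.univ (D.box A B) K ▷ L.A ≫
        D.univ (D.box (D.box A B) K) L ≫ h.f) : g = h := by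
  refine D.box_box_hom_ext ?_
  have hl : (distributorRight T K.A).IsLinear (X := D.box A B) (D.univ (D.box A B) K) :=
    (D.univ_isBilinear _ K).left
  exact D.linear_ext ((distributorRight T K.A).comp (distributorRight T L.A))
    ((tensorRightAdjunction K.A).comp (tensorRightAdjunction L.A))
    (hl.comp (t := distributorRight T L.A) D.univ_comp_isLinear_left)
    (hl.comp (t := distributorRight T L.A) D.univ_comp_isLinear_left) e

/-- Trilinear morphisms extend to `(A ⊠ B) ⊠ K`. -/
theorem exists_box_box_hom (f : (A.A ⊗ B.A) ⊗ K.A ⟶ Z.A) (hf : IsTrilinear f) :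
    ∃ g : D.box (D.box A B) K ⟶ Z,
      D.univ A B ▷ K.A ≫ D.univ (D.box A B) K ≫ g.f = f := by
  obtain ⟨g, hg, e⟩ := D.exists_linear (distributorRight T K.A) (tensorRightAdjunction K.A) f
    hf.left
  replace e : D.univ A B ▷ K.A ≫ g = f := e
  replace hg : strengthLeft T (D.box A B).A K.A ≫ T.map g ≫ Z.a = (D.box A B).a ▷ K.A ≫ g := hg
  have hb : IsBilinear (A := D.box A B) (B := K) g := by
    refine isBilinear_of_left_of_right hg ?_
    refine D.whiskerRight_univ_ext (T.obj K.A) (isLinear_left_strengthRight hg) ?_ ?_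
    · rw [isLinear_left_iff, T.map_comp, Category.assoc, ← reassoc_of% strengthLeft_natural_right,
        hg, whisker_exchange_assoc]
    · rw [reassoc_of% strengthRight_natural_left, ← T.map_comp_assoc, e, hf.right,
        ← whisker_exchange_assoc, e]
  exact ⟨D.lift g hb, by rw [univ_lift, e]⟩

/-- The two universal trilinear morphisms, rebracketed by `α` and its inverse, each factor through
the other product; uniqueness makes the factorizations mutually inverse. -/
theorem exists_assoc (A B K : T.Algebra) :
    ∃ i : D.box (D.box A B) K ≅ D.box A (D.box B K),
      D.univ A B ▷ K.A ≫ D.univ (D.box A B) K ≫ i.hom.f =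
        (α_ A.A B.A K.A).hom ≫ A.A ◁ D.univ B K ≫ D.univ A (D.box B K) := by
  obtain ⟨g, hg⟩ := D.exists_box_box_hom _
    ((D.univ_isBilinear B K).whiskerLeft_comp (D.univ_isBilinear A _)).associator_comp
  obtain ⟨h, hh⟩ := D.exists_box_box_hom' _
    ((D.univ_isBilinear A B).whiskerRight_comp (D.univ_isBilinear _ K)).associator_inv_comp
  refine ⟨⟨g, h, D.box_box_hom_ext ?_, D.box_box_hom_ext' ?_⟩, hg⟩
  · rw [Monad.Algebra.comp_f, reassoc_of% hg, hh, Iso.hom_inv_id_assoc, Monad.Algebra.id_f,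
      Category.comp_id]
  · rw [Monad.Algebra.comp_f, reassoc_of% hh, hg, Iso.inv_hom_id_assoc, Monad.Algebra.id_f,
      Category.comp_id]

end

end Tensors

/-- The morphism in question is the linear extension of `f` from `F X` to `F (TX)`. -/
theorem Distributor.isLinear_free {C : Type u} [Category.{v} C] {T : Monad C} {F : C ⥤ C}
    (s : Distributor T F) {X : C} {Z : T.Algebra} (f : F.obj X ⟶ Z.A) :
    s.IsLinear (X := T.free.obj X) (Z := Z) (s.app X ≫ T.map f ≫ Z.a) := by
  have h : T.map (T.map f) ≫ T.μ.app Z.A = T.μ.app (F.obj X) ≫ T.map f := T.μ.naturality f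
  change s.app (T.obj X) ≫ T.map (s.app X ≫ T.map f ≫ Z.a) ≫ Z.a =
    F.map (T.μ.app X) ≫ s.app X ≫ T.map f ≫ Z.a
  rw [reassoc_of% s.mul, ← reassoc_of% h, Z.assoc]
  simp only [T.map_comp, Category.assoc]

/-! ### Bilinear morphisms with a free factor, and the unit object -/

section Unit

variable {C : Type u} [Category.{v} C] [MonoidalCategory C] {T : Monad C} [MonoidalMonad T]

theorem isBilinear_strengthLeft {L : C} {X Z : T.Algebra} {g : L ⊗ X.A ⟶ Z.A}
    (hg : strengthRight T L X.A ≫ T.map g ≫ Z.a = L ◁ X.a ≫ g) :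
    IsBilinear (A := T.free.obj L) (strengthLeft T L X.A ≫ T.map g ≫ Z.a) :=
  isBilinear_of_left_of_right ((distributorRight T X.A).isLinear_free g)
    (isLinear_right_strengthLeft hg)

theorem isBilinear_strengthRight {L : C} {X Z : T.Algebra} {g : X.A ⊗ L ⟶ Z.A}
    (hg : strengthLeft T X.A L ≫ T.map g ≫ Z.a = X.a ▷ L ≫ g) :
    IsBilinear (B := T.free.obj L) (strengthRight T X.A L ≫ T.map g ≫ Z.a) :=
  isBilinear_of_left_of_right (isLinear_left_strengthRight hg)
    ((distributorLeft T X.A).isLinear_free g)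

theorem leftUnitor_isLinear (A : T.Algebra) :
    strengthRight T (𝟙_ C) A.A ≫ T.map (λ_ A.A).hom ≫ A.a = 𝟙_ C ◁ A.a ≫ (λ_ A.A).hom := by
  rw [reassoc_of% strengthRight_leftUnitor, leftUnitor_naturality]

theorem rightUnitor_isLinear (A : T.Algebra) :
    strengthLeft T A.A (𝟙_ C) ≫ T.map (ρ_ A.A).hom ≫ A.a = A.a ▷ 𝟙_ C ≫ (ρ_ A.A).hom := by
  rw [reassoc_of% strengthLeft_rightUnitor, rightUnitor_naturality]

/-- This is the associativity of `κ` with `E` in the middle and units inserted in the outer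
variables, combined with the triangle in `C`. It carries the triangle law for algebras. -/
theorem strengthLeft_triangle (X Y : C) :
    (α_ X (T.obj (𝟙_ C)) Y).hom ≫ X ◁ (strengthLeft T (𝟙_ C) Y ≫ T.map (λ_ Y).hom) ≫
        strengthRight T X Y =
      (strengthRight T X (𝟙_ C) ≫ T.map (ρ_ X).hom) ▷ Y ≫ strengthLeft T X Y := by
  have h := kappa_assoc T X (𝟙_ C) Y
  have ht : T.map (α_ X (𝟙_ C) Y).hom ≫ T.map (X ◁ (λ_ Y).hom) = T.map ((ρ_ X).hom ▷ Y) := by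
    rw [← T.map_comp, triangle]
  simp only [strengthLeft, strengthRight, comp_whiskerRight, MonoidalCategory.whiskerLeft_comp,
    Category.assoc]
  have hr : kappa T X (𝟙_ C) ▷ Y ≫ T.map (ρ_ X).hom ▷ Y ≫ T.obj X ◁ T.η.app Y ≫ kappa T X Y =
      (T.obj X ⊗ T.obj (𝟙_ C)) ◁ T.η.app Y ≫ (α_ _ _ _).hom ≫ T.obj X ◁ kappa T (𝟙_ C) Y ≫
        kappa T X (𝟙_ C ⊗ Y) ≫ T.map (X ◁ (λ_ Y).hom) := by
    rw [← whisker_exchange_assoc, ← whisker_exchange_assoc, kappa_natural_left, ← ht,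
      reassoc_of% h]
  rw [hr, whisker_exchange_assoc, whisker_exchange_assoc, whisker_exchange_assoc,
    kappa_natural_right]
  simp

section Left

variable {A X : T.Algebra} {u : T.obj (𝟙_ C) ⊗ A.A ⟶ X.A}

theorem leftUnitor_inv_unit_comp_linear
    (hr : strengthRight T (T.obj (𝟙_ C)) A.A ≫ T.map u ≫ X.a = T.obj (𝟙_ C) ◁ A.a ≫ u) :
    T.map ((λ_ A.A).inv ≫ T.η.app (𝟙_ C) ▷ A.A ≫ u) ≫ X.a =
      A.a ≫ (λ_ A.A).inv ≫ T.η.app (𝟙_ C) ▷ A.A ≫ u := by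
  have h := strengthRight_natural_left T (T.η.app (𝟙_ C)) A.A
  dsimp only [Functor.id_obj] at h ⊢
  rw [T.map_comp, T.map_comp, Category.assoc, Category.assoc, ← leftUnitor_inv_strengthRight,
    Category.assoc, ← reassoc_of% h, leftUnitor_inv_naturality_assoc, whisker_exchange_assoc, hr]

/-- As `u` is linear on the free algebra `TE`, it is recovered from its restriction along `η_E`.
That restriction is linear in `A`, which lets it pass through the structure map of `A`. -/
theorem strengthLeft_comp_leftUnitor_inv_unit
    (hl : strengthLeft T (T.obj (𝟙_ C)) A.A ≫ T.map u ≫ X.a = T.μ.app (𝟙_ C) ▷ A.A ≫ u)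
    (hr : strengthRight T (T.obj (𝟙_ C)) A.A ≫ T.map u ≫ X.a = T.obj (𝟙_ C) ◁ A.a ≫ u) :
    (strengthLeft T (𝟙_ C) A.A ≫ T.map (λ_ A.A).hom ≫ A.a) ≫
      (λ_ A.A).inv ≫ T.η.app (𝟙_ C) ▷ A.A ≫ u = u := by
  have h := strengthLeft_natural_left T (T.η.app (𝟙_ C)) A.A
  have h' : T.map (T.η.app (𝟙_ C)) ▷ A.A ≫ T.μ.app (𝟙_ C) ▷ A.A = 𝟙 _ :=
    (comp_whiskerRight _ _ _).symm.trans
      ((congrArg (· ▷ A.A) (T.right_unit (𝟙_ C))).trans (id_whiskerRight _ _))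
  have e := leftUnitor_inv_unit_comp_linear hr
  dsimp only [Functor.id_obj, Functor.comp_obj] at h h' e ⊢
  rw [Category.assoc, Category.assoc, ← e, ← T.map_comp_assoc, Iso.hom_inv_id_assoc, T.map_comp,
    Category.assoc, ← reassoc_of% h, hl, reassoc_of% h']

theorem leftUnitor_inv_unit_strengthLeft (A : T.Algebra) :
    (λ_ A.A).inv ≫ T.η.app (𝟙_ C) ▷ A.A ≫ strengthLeft T (𝟙_ C) A.A ≫ T.map (λ_ A.A).hom ≫ A.a =
      𝟙 A.A := by
  have h : T.η.app A.A ≫ A.a = 𝟙 A.A := A.unit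
  have h' : (λ_ A.A).hom ≫ T.η.app A.A = T.η.app (𝟙_ C ⊗ A.A) ≫ T.map (λ_ A.A).hom :=
    T.η.naturality _
  have e := unit_strengthLeft T (𝟙_ C) A.A
  dsimp only [Functor.id_obj] at h h' e ⊢
  rw [reassoc_of% e, ← reassoc_of% h', h, Iso.inv_hom_id_assoc]

end Left

section Right

variable {A X : T.Algebra} {u : A.A ⊗ T.obj (𝟙_ C) ⟶ X.A}

theorem rightUnitor_inv_unit_comp_linear
    (hl : strengthLeft T A.A (T.obj (𝟙_ C)) ≫ T.map u ≫ X.a = A.a ▷ T.obj (𝟙_ C) ≫ u) :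
    T.map ((ρ_ A.A).inv ≫ A.A ◁ T.η.app (𝟙_ C) ≫ u) ≫ X.a =
      A.a ≫ (ρ_ A.A).inv ≫ A.A ◁ T.η.app (𝟙_ C) ≫ u := by
  have h := strengthLeft_natural_right T A.A (T.η.app (𝟙_ C))
  dsimp only [Functor.id_obj] at h ⊢
  rw [T.map_comp, T.map_comp, Category.assoc, Category.assoc, ← rightUnitor_inv_strengthLeft,
    Category.assoc, ← reassoc_of% h, rightUnitor_inv_naturality_assoc, ← whisker_exchange_assoc,
    hl]

theorem strengthRight_comp_rightUnitor_inv_unit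
    (hl : strengthLeft T A.A (T.obj (𝟙_ C)) ≫ T.map u ≫ X.a = A.a ▷ T.obj (𝟙_ C) ≫ u)
    (hr : strengthRight T A.A (T.obj (𝟙_ C)) ≫ T.map u ≫ X.a = A.A ◁ T.μ.app (𝟙_ C) ≫ u) :
    (strengthRight T A.A (𝟙_ C) ≫ T.map (ρ_ A.A).hom ≫ A.a) ≫
      (ρ_ A.A).inv ≫ A.A ◁ T.η.app (𝟙_ C) ≫ u = u := by
  have h := strengthRight_natural_right T A.A (T.η.app (𝟙_ C))
  have h' : A.A ◁ T.map (T.η.app (𝟙_ C)) ≫ A.A ◁ T.μ.app (𝟙_ C) = 𝟙 _ :=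
    (MonoidalCategory.whiskerLeft_comp _ _ _).symm.trans
      ((congrArg (A.A ◁ ·) (T.right_unit (𝟙_ C))).trans (whiskerLeft_id _ _))
  have e := rightUnitor_inv_unit_comp_linear hl
  dsimp only [Functor.id_obj, Functor.comp_obj] at h h' e ⊢
  rw [Category.assoc, Category.assoc, ← e, ← T.map_comp_assoc, Iso.hom_inv_id_assoc, T.map_comp,
    Category.assoc, ← reassoc_of% h, hr, reassoc_of% h']

theorem rightUnitor_inv_unit_strengthRight (A : T.Algebra) :
    (ρ_ A.A).inv ≫ A.A ◁ T.η.app (𝟙_ C) ≫ strengthRight T A.A (𝟙_ C) ≫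
      T.map (ρ_ A.A).hom ≫ A.a = 𝟙 A.A := by
  have h : T.η.app A.A ≫ A.a = 𝟙 A.A := A.unit
  have h' : (ρ_ A.A).hom ≫ T.η.app A.A = T.η.app (A.A ⊗ 𝟙_ C) ≫ T.map (ρ_ A.A).hom :=
    T.η.naturality _
  have e := unit_strengthRight T A.A (𝟙_ C)
  dsimp only [Functor.id_obj] at h h' e ⊢
  rw [reassoc_of% e, ← reassoc_of% h', h, Iso.inv_hom_id_assoc]

end Right

end Unit

/-! ### Existence of the unitors, and the induced conditions on generators -/

namespace Tensors

section

variable {C : Type u} [Category.{v} C] [MonoidalCategory C] {T : Monad C} [MonoidalMonad T]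
  (D : Tensors T)

theorem q_comp_eq_extend_iff {A B Z : T.Algebra} (g : D.box A B ⟶ Z) (f : A.A ⊗ B.A ⟶ Z.A) :
    D.q A B ≫ g = extend T Z f ↔ D.univ A B ≫ g.f = f := by
  rw [univ, ← restrict_comp]
  exact ⟨fun e => by rw [e, restrict_extend], fun e => by rw [← e, extend_restrict]⟩

theorem exists_left (A : T.Algebra) :
    ∃ i : D.box (T.free.obj (𝟙_ C)) A ≅ A,
      D.univ (T.free.obj (𝟙_ C)) A ≫ i.hom.f =
        strengthLeft T (𝟙_ C) A.A ≫ T.map (λ_ A.A).hom ≫ A.a := by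
  have hb := isBilinear_strengthLeft (leftUnitor_isLinear A)
  have hu := D.univ_isBilinear (T.free.obj (𝟙_ C)) A
  let u : T.obj (𝟙_ C) ⊗ A.A ⟶ (D.box (T.free.obj (𝟙_ C)) A).A := D.univ (T.free.obj (𝟙_ C)) A
  let l := D.lift _ hb
  have hl : u ≫ l.f = strengthLeft T (𝟙_ C) A.A ≫ T.map (λ_ A.A).hom ≫ A.a := D.univ_lift _ hb
  let j : A ⟶ D.box (T.free.obj (𝟙_ C)) A :=
    { f := (λ_ A.A).inv ≫ T.η.app (𝟙_ C) ▷ A.A ≫ u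
      h := leftUnitor_inv_unit_comp_linear hu.right }
  have hj : (u ≫ l.f) ≫ j.f = u := by
    rw [hl]
    exact strengthLeft_comp_leftUnitor_inv_unit hu.left hu.right
  refine ⟨⟨l, j, D.box_hom_ext ?_, ?_⟩, hl⟩
  · exact (Category.assoc _ _ _).symm.trans (hj.trans (Category.comp_id _).symm)
  · ext
    change ((λ_ A.A).inv ≫ T.η.app (𝟙_ C) ▷ A.A ≫ u) ≫ l.f = 𝟙 A.A
    refine (Category.assoc _ _ _).trans ((congrArg (_ ≫ ·) (Category.assoc _ _ _)).trans ?_)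
    rw [hl]
    exact leftUnitor_inv_unit_strengthLeft A

theorem exists_right (A : T.Algebra) :
    ∃ i : D.box A (T.free.obj (𝟙_ C)) ≅ A,
      D.univ A (T.free.obj (𝟙_ C)) ≫ i.hom.f =
        strengthRight T A.A (𝟙_ C) ≫ T.map (ρ_ A.A).hom ≫ A.a := by
  have hb := isBilinear_strengthRight (rightUnitor_isLinear A)
  have hu := D.univ_isBilinear A (T.free.obj (𝟙_ C))
  let u : A.A ⊗ T.obj (𝟙_ C) ⟶ (D.box A (T.free.obj (𝟙_ C))).A := D.univ A (T.free.obj (𝟙_ C))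
  let l := D.lift _ hb
  have hl : u ≫ l.f = strengthRight T A.A (𝟙_ C) ≫ T.map (ρ_ A.A).hom ≫ A.a := D.univ_lift _ hb
  let j : A ⟶ D.box A (T.free.obj (𝟙_ C)) :=
    { f := (ρ_ A.A).inv ≫ A.A ◁ T.η.app (𝟙_ C) ≫ u
      h := rightUnitor_inv_unit_comp_linear hu.left }
  have hj : (u ≫ l.f) ≫ j.f = u := by
    rw [hl]
    exact strengthRight_comp_rightUnitor_inv_unit hu.left hu.right
  refine ⟨⟨l, j, D.box_hom_ext ?_, ?_⟩, hl⟩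
  · exact (Category.assoc _ _ _).symm.trans (hj.trans (Category.comp_id _).symm)
  · ext
    change ((ρ_ A.A).inv ≫ A.A ◁ T.η.app (𝟙_ C) ≫ u) ≫ l.f = 𝟙 A.A
    refine (Category.assoc _ _ _).trans ((congrArg (_ ≫ ·) (Category.assoc _ _ _)).trans ?_)
    rw [hl]
    exact rightUnitor_inv_unit_strengthRight A

/-- The inverse of the identification inserts `η_X ⊗ η_Y`, which restricts `g` and `h` to
generators. -/
theorem restrict_freeIso_inv_map {X Y : C} {A B : T.Algebra} (g : T.free.obj X ⟶ A)
    (h : T.free.obj Y ⟶ B) :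
    restrict ((D.freeIso X Y).inv ≫ D.map g h) = (restrict g ⊗ₘ restrict h) ≫ D.univ A B := by
  have e : (D.freeIso X Y).inv ≫ D.map g h =
      T.free.map (T.η.app X ⊗ₘ T.η.app Y) ≫ D.q (T.free.obj X) (T.free.obj Y) ≫ D.map g h :=
    Category.assoc _ _ _
  have e' : restrict (D.q (T.free.obj X) (T.free.obj Y) ≫ D.map g h) =
      (g.f ⊗ₘ h.f) ≫ D.univ A B := by
    rw [q_map, restrict_map_comp, univ]
  rw [e]
  refine (restrict_map_comp _ _).trans ((congrArg (_ ≫ ·) e').trans ?_)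
  exact tensorHom_comp_tensorHom_assoc (T.η.app X) (T.η.app Y) g.f h.f _

/-- Both sides of the square start at a free algebra; restricting them to generators removes
`freeIso` and the structure maps. -/
theorem assoc_induced_iff {A B K : T.Algebra}
    (g : D.box (D.box A B) K ⟶ D.box A (D.box B K)) :
    ((D.freeIso (A.A ⊗ B.A) K.A).inv ≫ D.map (D.q A B) (str T K)) ≫ g =
      T.free.map (α_ A.A B.A K.A).hom ≫
        ((D.freeIso A.A (B.A ⊗ K.A)).inv ≫ D.map (str T A) (D.q B K)) ↔
    D.univ A B ▷ K.A ≫ D.univ (D.box A B) K ≫ g.f =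
      (α_ A.A B.A K.A).hom ≫ A.A ◁ D.univ B K ≫ D.univ A (D.box B K) := by
  have hl : restrict (((D.freeIso (A.A ⊗ B.A) K.A).inv ≫ D.map (D.q A B) (str T K)) ≫ g) =
      D.univ A B ▷ K.A ≫ D.univ (D.box A B) K ≫ g.f := by
    rw [restrict_comp, restrict_freeIso_inv_map, restrict_str, tensorHom_id, Category.assoc]
    rfl
  have hr : restrict (T.free.map (α_ A.A B.A K.A).hom ≫
        ((D.freeIso A.A (B.A ⊗ K.A)).inv ≫ D.map (str T A) (D.q B K))) =
      (α_ A.A B.A K.A).hom ≫ A.A ◁ D.univ B K ≫ D.univ A (D.box B K) := by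
    rw [restrict_map_comp, restrict_freeIso_inv_map, restrict_str, id_tensorHom]
    rfl
  rw [← hl, ← hr]
  exact ⟨congrArg _, free_hom_ext⟩

end

namespace StructureIsos.IsInduced

variable {C : Type u} [Category.{v} C] [MonoidalCategory C] {T : Monad C} [MonoidalMonad T]
  {D : Tensors T} {S : D.StructureIsos} (hS : S.IsInduced)

include hS

theorem univ_assoc (A B K : T.Algebra) :
    D.univ A B ▷ K.A ≫ D.univ (D.box A B) K ≫ (S.assoc A B K).hom.f =
      (α_ A.A B.A K.A).hom ≫ A.A ◁ D.univ B K ≫ D.univ A (D.box B K) :=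
  (D.assoc_induced_iff _).1 (hS.assoc A B K)

theorem univ_left (A : T.Algebra) :
    D.univ (T.free.obj (𝟙_ C)) A ≫ (S.left A).hom.f =
      strengthLeft T (𝟙_ C) A.A ≫ T.map (λ_ A.A).hom ≫ A.a := by
  rw [strengthLeft, Category.assoc]
  exact (D.q_comp_eq_extend_iff _ _).1 (hS.left A)

theorem univ_right (A : T.Algebra) :
    D.univ A (T.free.obj (𝟙_ C)) ≫ (S.right A).hom.f =
      strengthRight T A.A (𝟙_ C) ≫ T.map (ρ_ A.A).hom ≫ A.a := by
  rw [strengthRight, Category.assoc]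
  exact (D.q_comp_eq_extend_iff _ _).1 (hS.right A)

end StructureIsos.IsInduced

section

variable {C : Type u} [Category.{v} C] [MonoidalCategory C] {T : Monad C} [MonoidalMonad T]
  (D : Tensors T)

theorem map_id_id (A B : T.Algebra) : D.map (𝟙 A) (𝟙 B) = 𝟙 (D.box A B) := by
  refine D.box_hom_ext ?_
  rw [univ_map, Monad.Algebra.id_f, Monad.Algebra.id_f, Monad.Algebra.id_f, id_tensorHom_id,
    Category.id_comp, Category.comp_id]

theorem map_comp_map {A A' A'' B B' B'' : T.Algebra} (f : A ⟶ A') (f' : A' ⟶ A'') (g : B ⟶ B')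
    (g' : B' ⟶ B'') : D.map f g ≫ D.map f' g' = D.map (f ≫ f') (g ≫ g') := by
  refine D.box_hom_ext ?_
  rw [Monad.Algebra.comp_f, reassoc_of% D.univ_map f g, univ_map, univ_map, Monad.Algebra.comp_f,
    Monad.Algebra.comp_f, tensorHom_comp_tensorHom_assoc]

theorem StructureIsos.ext_hom {S S' : D.StructureIsos}
    (ha : ∀ A B K, (S.assoc A B K).hom = (S'.assoc A B K).hom)
    (hl : ∀ A, (S.left A).hom = (S'.left A).hom) (hr : ∀ A, (S.right A).hom = (S'.right A).hom) :
    S = S' := by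
  obtain ⟨a, l, r⟩ := S
  obtain ⟨a', l', r'⟩ := S'
  congr
  · funext A B K
    exact Iso.ext (ha A B K)
  · funext A
    exact Iso.ext (hl A)
  · funext A
    exact Iso.ext (hr A)

end

/-! ### Naturality and coherence -/

section

variable {C : Type u} [Category.{v} C] [MonoidalCategory C] {T : Monad C} [MonoidalMonad T]
  {D : Tensors T} {S : D.StructureIsos}

theorem StructureIsos.IsInduced.left_naturality (hS : S.IsInduced) {A B : T.Algebra}
    (f : A ⟶ B) : D.map (𝟙 (T.free.obj (𝟙_ C))) f ≫ (S.left B).hom = (S.left A).hom ≫ f := by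
  refine D.box_hom_ext ?_
  have h : T.obj (𝟙_ C) ◁ f.f ≫ strengthLeft T (𝟙_ C) B.A ≫ T.map (λ_ B.A).hom ≫ B.a =
      (strengthLeft T (𝟙_ C) A.A ≫ T.map (λ_ A.A).hom ≫ A.a) ≫ f.f := by
    rw [reassoc_of% strengthLeft_natural_right, ← T.map_comp_assoc, leftUnitor_naturality,
      T.map_comp, Category.assoc, f.h]
    simp only [Category.assoc]
  rw [Monad.Algebra.comp_f, Monad.Algebra.comp_f,
    reassoc_of% D.univ_map_id_left (T.free.obj (𝟙_ C)) f, hS.univ_left]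
  exact h.trans (congrArg (· ≫ f.f) (hS.univ_left A).symm |>.trans (Category.assoc _ _ _))

theorem StructureIsos.IsInduced.right_naturality (hS : S.IsInduced) {A B : T.Algebra}
    (f : A ⟶ B) : D.map f (𝟙 (T.free.obj (𝟙_ C))) ≫ (S.right B).hom = (S.right A).hom ≫ f := by
  refine D.box_hom_ext ?_
  have h : f.f ▷ T.obj (𝟙_ C) ≫ strengthRight T B.A (𝟙_ C) ≫ T.map (ρ_ B.A).hom ≫ B.a =
      (strengthRight T A.A (𝟙_ C) ≫ T.map (ρ_ A.A).hom ≫ A.a) ≫ f.f := by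
    rw [reassoc_of% strengthRight_natural_left, ← T.map_comp_assoc, rightUnitor_naturality,
      T.map_comp, Category.assoc, f.h]
    simp only [Category.assoc]
  rw [Monad.Algebra.comp_f, Monad.Algebra.comp_f, reassoc_of% D.univ_map_id_right f,
    hS.univ_right]
  exact h.trans (congrArg (· ≫ f.f) (hS.univ_right A).symm |>.trans (Category.assoc _ _ _))

end

variable {C : Type u} [Category.{v} C] [MonoidalCategory C] [SymmetricCategory C]
  [MonoidalClosed C] {T : Monad C} [MonoidalMonad T] {D : Tensors T} {S : D.StructureIsos}

namespace StructureIsos.IsInduced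

theorem assoc_naturality (hS : S.IsInduced) {A A' B B' K K' : T.Algebra} (f : A ⟶ A')
    (g : B ⟶ B') (h : K ⟶ K') :
    D.map (D.map f g) h ≫ (S.assoc A' B' K').hom =
      (S.assoc A B K).hom ≫ D.map f (D.map g h) := by
  refine D.box_box_hom_ext ?_
  have hl : D.univ A B ▷ K.A ≫ ((D.map f g).f ⊗ₘ h.f) =
      ((f.f ⊗ₘ g.f) ⊗ₘ h.f) ≫ D.univ A' B' ▷ K'.A := by
    rw [← tensorHom_id, ← tensorHom_id, tensorHom_comp_tensorHom, tensorHom_comp_tensorHom,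
      univ_map, Category.id_comp, Category.comp_id]
  have hr : A.A ◁ D.univ B K ≫ (f.f ⊗ₘ (D.map g h).f) =
      (f.f ⊗ₘ g.f ⊗ₘ h.f) ≫ A'.A ◁ D.univ B' K' := by
    rw [← id_tensorHom, ← id_tensorHom, tensorHom_comp_tensorHom, tensorHom_comp_tensorHom,
      univ_map, Category.id_comp, Category.comp_id]
  rw [Monad.Algebra.comp_f, Monad.Algebra.comp_f, reassoc_of% D.univ_map (D.map f g) h,
    reassoc_of% hl, hS.univ_assoc, reassoc_of% hS.univ_assoc, univ_map, reassoc_of% hr,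
    associator_naturality_assoc]

/-- On `((A ⊗ B) ⊗ K) ⊗ L` each induced associator passes the universal morphisms as `α`, which
leaves the pentagon in `C`. -/
theorem pentagon (hS : S.IsInduced) (A B K L : T.Algebra) :
    D.map (S.assoc A B K).hom (𝟙 L) ≫ (S.assoc A (D.box B K) L).hom ≫
        D.map (𝟙 A) (S.assoc B K L).hom =
      (S.assoc (D.box A B) K L).hom ≫ (S.assoc A B (D.box K L)).hom := by
  refine D.box_box_box_hom_ext ?_
  simp only [Monad.Algebra.comp_f]
  have h := congrArg (· ▷ L.A) (hS.univ_assoc A B K)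
  simp only [comp_whiskerRight] at h
  have h' := congrArg (A.A ◁ ·) (hS.univ_assoc B K L)
  simp only [MonoidalCategory.whiskerLeft_comp] at h'
  rw [reassoc_of% D.univ_map_id_right (S.assoc A B K).hom L, reassoc_of% h,
    reassoc_of% hS.univ_assoc,
    D.univ_map_id_left, reassoc_of% hS.univ_assoc (D.box A B) K L, associator_naturality_left_assoc,
    ← whisker_exchange_assoc, hS.univ_assoc]
  simp only [whisker_assoc, Category.assoc, Iso.inv_hom_id_assoc, reassoc_of% h']
  simp

theorem triangle (hS : S.IsInduced) (A B : T.Algebra) :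
    (S.assoc A (T.free.obj (𝟙_ C)) B).hom ≫ D.map (𝟙 A) (S.left B).hom =
      D.map (S.right A).hom (𝟙 B) := by
  refine D.box_box_hom_ext ?_
  have h := congrArg (A.A ◁ ·) (hS.univ_left B)
  simp only [MonoidalCategory.whiskerLeft_comp] at h
  have h' := congrArg (· ▷ B.A) (hS.univ_right A)
  simp only [comp_whiskerRight] at h'
  have e := strengthLeft_triangle (T := T) A.A B.A
  simp only [MonoidalCategory.whiskerLeft_comp, comp_whiskerRight, Category.assoc] at e
  rw [Monad.Algebra.comp_f, reassoc_of% hS.univ_assoc, D.univ_map_id_left, D.univ_map_id_right,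
    reassoc_of% h, reassoc_of% h']
  change (α_ A.A (T.obj (𝟙_ C)) B.A).hom ≫
      A.A ◁ (strengthLeft T (𝟙_ C) B.A ≫ T.map (λ_ B.A).hom ≫ B.a) ≫ D.univ A B =
    (strengthRight T A.A (𝟙_ C) ≫ T.map (ρ_ A.A).hom ≫ A.a) ▷ B.A ≫ D.univ A B
  simp only [MonoidalCategory.whiskerLeft_comp, comp_whiskerRight, Category.assoc]
  -- Bilinearity of `univ` trades the structure maps of `A` and `B` for strengths, so that both
  -- sides end in `T univ` and the structure map of `A ⊠ B`.
  rw [← (D.univ_isBilinear A B).left, ← (D.univ_isBilinear A B).right, reassoc_of% e]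

theorem exists_monoidalCategory (hS : S.IsInduced) :
    ∃ M : MonoidalCategory T.Algebra, M.toMonoidalCategoryStruct = S.toStruct :=
  ⟨{ S.toStruct with
      tensorHom_def := fun f g => by
        refine Eq.trans ?_ (D.map_comp_map f (𝟙 _) (𝟙 _) g).symm
        rw [Category.comp_id, Category.id_comp]
        rfl
      id_tensorHom_id := D.map_id_id
      tensorHom_comp_tensorHom := fun f g f' g' => D.map_comp_map f f' g g'
      whiskerLeft_id := D.map_id_id
      id_whiskerRight := D.map_id_id
      associator_naturality := hS.assoc_naturality
      leftUnitor_naturality := hS.left_naturality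
      rightUnitor_naturality := hS.right_naturality
      pentagon := hS.pentagon
      triangle := hS.triangle }, rfl⟩

end StructureIsos.IsInduced

variable (D) in
theorem existsUnique_isInduced : ∃! S : D.StructureIsos, S.IsInduced := by
  choose a ha using D.exists_assoc
  choose l hl using D.exists_left
  choose r hr using D.exists_right
  refine ⟨⟨a, l, r⟩, ⟨fun A B K => (D.assoc_induced_iff _).2 (ha A B K), fun A => ?_,
    fun A => ?_⟩, fun S hS => StructureIsos.ext_hom D (fun A B K => ?_) (fun A => ?_) fun A => ?_⟩
  · have h := (D.q_comp_eq_extend_iff _ _).2 (hl A)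
    rw [strengthLeft, Category.assoc] at h
    exact h
  · have h := (D.q_comp_eq_extend_iff _ _).2 (hr A)
    rw [strengthRight, Category.assoc] at h
    exact h
  · exact D.box_box_hom_ext ((hS.univ_assoc A B K).trans (ha A B K).symm)
  · exact D.box_hom_ext ((hS.univ_left A).trans (hl A).symm)
  · exact D.box_hom_ext ((hS.univ_right A).trans (hr A).symm)

end Tensors

end MonoidalMonad

theorem mainTheorem5 {C : Type u} [Category.{v} C] [MonoidalCategory C] [SymmetricCategory C]
    [MonoidalClosed C] [HasEqualizers C] (T : Monad C) [MonoidalMonad T]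
    (D : MonoidalMonad.Tensors T) :
    (∃! S : D.StructureIsos, S.IsInduced) ∧
      ∀ S : D.StructureIsos, S.IsInduced →
        ∃ M : MonoidalCategory T.Algebra, M.toMonoidalCategoryStruct = S.toStruct :=
  ⟨D.existsUnique_isInduced, fun _ hS => hS.exists_monoidalCategory⟩
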